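/- Let $\mathcal U$ be a non-principal ultrafilter on $\mathbb N$. A \emph{tracial $\mathrm W^*$-algebra} $\mathcal M=(M,\tau)$ is a von Neumann algebra $M\subseteq B(H)$ with a faithful normal tracial state $\tau$; put $d(x,y)=\|x-y\|_2$ with $\|x\|_2=\tau(x^*x)^{1/2}$, and let $D_s^{\mathcal M}=\{x\in M:\|x\|\le s\}$ for $s>0$. The matrix algebra $M_n(\mathbb C)$ carries its normalized trace $\operatorname{tr}_n$. \emph{Formulas and types.} A quantifier-free formula in variables $(x_v)_{v\in V}$ is obtained from the expressions $d(s,t)$, $\operatorname{Re}\operatorname{tr}(t)$, $\operatorname{Im}\operatorname{tr}(t)$, where $s,t$ are non-commutative $*$-polynomial terms in the $x_v$, by iteratively applying continuous functions $\mathbb R^k\to\mathbb R$. An existential formula is an expression $\phi(\mathbf x)=\inf_{y_1\in D_{\rho_1},\dots,y_k\in D_{\rho_k}}\psi(\mathbf x,y_1,\dots,y_k)$ with $\psi$ quantifier-free and $\rho_i>0$. The quantifier-free type $\operatorname{tp}_{\mathrm{qf}}^{\mathcal M}(\mathbf X)$ (resp. existential type $\operatorname{tp}_\exists^{\mathcal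 M}(\mathbf X)$) of a tuple $\mathbf X$ in $M$ is the map $\phi\mapsto\phi^{\mathcal M}(\mathbf X)$ on quantifier-free (resp. existential) formulas. For $\mathbf s\in(0,\infty)^V$, the set $\mathbb S_{\mathrm{qf},\mathbf s}$ of quantifier-free types of tuples in $\prod_{v}D_{s_v}^{\mathcal N}$, $\mathcal N$ ranging over tracial $\mathrm W^*$-algebras, has the topology of pointwise convergence. Let $\mathbb S_\exists$ be the set of existential types of $\mathbb N$-tuples in tracial $\mathrm W^*$-algebras and $\mathbb S_{\exists,\mathbf t}$ the subset of those realized in $\prod_j D_{t_j}$, for $\mathbf t\in(0,\infty)^{\mathbb N}$. A set $\mathcal O\subseteq\mathbb S_{\exists,\mathbf t}$ is open if for every $\mu\in\mathcal O$ there are existential formulas $\phi_1,\dots,\phi_k$ and $\epsilon_1,\dots,\epsilon_k>0$ with $\{\nu\in\mathbb S_{\exists,\mathbf t}:\nu(\phi_j)<\mu(\phi_j)+\epsilon_j,\ j=1,\dots,k\}\subseteq\mathcal O$; a set $\mathcal O\subseteq\mathbb S_\exists$ is open if $\mathcal O\cap\mathbb S_{\exists,\mathbf t}$ is open in $\mathbb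 S_{\exists,\mathbf t}$ for every $\mathbf t$. \emph{Covering numbers.} For $\Omega\subseteq M_n(\mathbb C)^V$, a finite $F\subseteq V$ and $\epsilon>0$, let $K^{\mathrm{orb}}_{F,\epsilon}(\Omega)$ be the least cardinality of a set $\Omega'\subseteq M_n(\mathbb C)^V$ such that for every $\mathbf Y\in\Omega$ there are $\mathbf X\in\Omega'$ and a unitary $W\in M_n(\mathbb C)$ with $\|Y_i-WX_iW^*\|_2<\epsilon$ for all $i\in F$. We use $\log 0=-\infty$, and limits along $\mathcal U$ are taken in $[-\infty,\infty]$. \emph{Existential entropy.} For $\mathcal O\subseteq\mathbb S_\exists$ let $\Gamma^{(n)}_{\mathbf t}(\mathcal O)=\{\mathbf X\in\prod_{j\in\mathbb N}D_{t_j}^{M_n(\mathbb C)}:\operatorname{tp}_\exists^{M_n(\mathbb C)}(\mathbf X)\in\mathcal O\}$. For $\mu\in\mathbb S_\exists$ and a $\mathrm W^*$-subalgebra $\mathcal N\subseteq\mathcal M$ set $$\operatorname{Ent}_\exists^{\mathcal U}(\mu)=\sup_{\mathbf t\in(0,\infty)^{\mathbb N}}\ \sup_{F\subseteq\mathbb N\text{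 finite}}\ \sup_{\epsilon>0}\ \inf_{\mathcal O\ni\mu\text{ open}}\ \lim_{n\to\mathcal U}\frac1{n^2}\log K^{\mathrm{orb}}_{F,\epsilon}\bigl(\Gamma^{(n)}_{\mathbf t}(\mathcal O)\bigr),\qquad \operatorname{Ent}_\exists^{\mathcal U}(\mathcal N:\mathcal M)=\sup_{\mathbf Z\in\mathcal N^{\mathbb N}}\operatorname{Ent}_\exists^{\mathcal U}\bigl(\operatorname{tp}_\exists^{\mathcal M}(\mathbf Z)\bigr).$$ \emph{Entropy in the presence.} Let $\mathcal M$ be a tracial $\mathrm W^*$-algebra, let $I,J$ be arbitrary index sets, $\mathbf X\in M^I$, $\mathbf Y\in M^J$, $\mathbf r\in(0,\infty)^I$, $\mathbf r'\in(0,\infty)^J$ with $\|X_i\|\le r_i$ and $\|Y_j\|\le r'_j$ for all $i\in I$, $j\in J$. For $\mathcal O\subseteq\mathbb S_{\mathrm{qf},(\mathbf r,\mathbf r')}$ let $\Gamma^{(n)}_{\mathbf r,\mathbf r'}(\mathcal O)$ be the set of $(\mathbf X',\mathbf Y')\in\prod_{i\in I}D_{r_i}^{M_n(\mathbb C)}\times\prod_{j\in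 J}D_{r'_j}^{M_n(\mathbb C)}$ with $\operatorname{tp}_{\mathrm{qf}}^{M_n(\mathbb C)}(\mathbf X',\mathbf Y')\in\mathcal O$, let $p$ be the projection $(\mathbf X',\mathbf Y')\mapsto\mathbf X'$, and set $$h^{\mathcal U}_{\mathbf r,\mathbf r'}(\mathbf X:\mathbf Y)=\sup_{\epsilon>0}\ \sup_{F\subseteq I\text{ finite}}\ \inf_{\mathcal O}\ \lim_{n\to\mathcal U}\frac1{n^2}\log K^{\mathrm{orb}}_{F,\epsilon}\bigl(p[\Gamma^{(n)}_{\mathbf r,\mathbf r'}(\mathcal O)]\bigr),$$ where $\mathcal O$ ranges over the neighbourhoods of $\operatorname{tp}_{\mathrm{qf}}^{\mathcal M}(\mathbf X,\mathbf Y)$ in $\mathbb S_{\mathrm{qf},(\mathbf r,\mathbf r')}$. Let $\mathrm W^*(\mathbf X)\subseteq\mathrm W^*(\mathbf X,\mathbf Y)$ be the von Neumann subalgebras of $M$ generated by the tuples, with the restricted trace. Then, in $[-\infty,\infty]$, $$h^{\mathcal U}_{\mathbf r,\mathbf r'}(\mathbf X:\mathbf Y)=\operatorname{Ent}_\exists^{\mathcal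 U}\bigl(\mathrm W^*(\mathbf X):\mathrm W^*(\mathbf X,\mathbf Y)\bigr).$$ -/

import Mathlib

open scoped ComplexOrder Matrix.Norms.L2Operator ENNReal
open Filter Topology

universe u v w

noncomputable section

/-! ## The language of tracial W*-algebras -/

/-- Terms of the language, with free variables indexed by `V`.  The constructor `poly` is the
family of function symbols `t_p`, one for each non-commutative polynomial `p`. -/
inductive TrTerm (V : Type v) : Type v
  | var (i : V) : TrTerm V
  | zero : TrTerm V
  | one : TrTerm V
  | add (s t : TrTerm V) : TrTerm V
  | mul (s t : TrTerm V) : TrTerm V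
  | adj (t : TrTerm V) : TrTerm V
  | scal (c : ℂ) (t : TrTerm V) : TrTerm V
  | poly {k : ℕ} (p : FreeAlgebra ℂ (Fin k)) (t : Fin k → TrTerm V) : TrTerm V

/-- Quantifier-free formulas: the basic formulas `d(s, t)`, `Re tr(t)`, `Im tr(t)`, closed under
continuous connectives `F : ℝ^k → ℝ`. -/
inductive QFFormula (V : Type v) : Type v
  | dist (s t : TrTerm V) : QFFormula V
  | reTr (t : TrTerm V) : QFFormula V
  | imTr (t : TrTerm V) : QFFormula V
  | conn {k : ℕ} (F : C(Fin k → ℝ, ℝ)) (φ : Fin k → QFFormula V) : QFFormula V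

/-- Existential formulas `inf_{y_1 ∈ D_{ρ_1}, …, y_k ∈ D_{ρ_k}} ψ(x, y_1, …, y_k)`, with `ψ`
quantifier-free, free variables `x` indexed by `V` and bound variables indexed by `Fin k`. -/
structure ExFormula (V : Type v) : Type v where
  k : ℕ
  radius : Fin k → ℝ
  radius_pos : ∀ i, 0 < radius i
  body : QFFormula (V ⊕ Fin k)

section Interpretation

variable {A : Type w}

/-- Interpretation of a term at a tuple `X`. -/
def TrTerm.eval [Ring A] [StarRing A] [Algebra ℂ A] {V : Type v} (X : V → A) : TrTerm V → A
  | .var i => X i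
  | .zero => 0
  | .one => 1
  | .add s t => s.eval X + t.eval X
  | .mul s t => s.eval X * t.eval X
  | .adj t => star (t.eval X)
  | .scal c t => c • t.eval X
  | .poly p t => FreeAlgebra.lift ℂ (fun i => (t i).eval X) p

/-- The norm `‖x‖₂ = τ(x* x)^{1/2}`. -/
def twoNorm [Ring A] [StarRing A] (τ : A → ℂ) (x : A) : ℝ :=
  Real.sqrt (τ (star x * x)).re

/-- Interpretation of a quantifier-free formula at a tuple `X`. -/
def QFFormula.eval [Ring A] [StarRing A] [Algebra ℂ A] (τ : A → ℂ) {V : Type v} (X : V → A) :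
    QFFormula V → ℝ
  | .dist s t => twoNorm τ (s.eval X - t.eval X)
  | .reTr t => (τ (t.eval X)).re
  | .imTr t => (τ (t.eval X)).im
  | .conn F φ => F (fun i => (φ i).eval τ X)

/-- The product `∏_j D_{r_j}` of the closed balls of radius `r_j` for the operator norm. -/
def ballProd [Norm A] {V : Type v} (r : V → ℝ) : Set (V → A) :=
  {X | ∀ j, ‖X j‖ ≤ r j}

/-- Interpretation of an existential formula at a tuple `X`. -/
def ExFormula.eval [Ring A] [StarRing A] [Algebra ℂ A] [Norm A] (τ : A → ℂ) {V : Type v}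
    (X : V → A) (φ : ExFormula V) : ℝ :=
  sInf ((fun Y : Fin φ.k → A => φ.body.eval τ (Sum.elim X Y)) '' ballProd φ.radius)

/-- The quantifier-free type of a tuple. -/
def qfType [Ring A] [StarRing A] [Algebra ℂ A] (τ : A → ℂ) {V : Type v} (X : V → A) :
    QFFormula V → ℝ :=
  fun φ => φ.eval τ X

/-- The existential type of a tuple. -/
def exType [Ring A] [StarRing A] [Algebra ℂ A] [Norm A] (τ : A → ℂ) {V : Type v} (X : V → A) :
    ExFormula V → ℝ :=
  fun φ => φ.eval τ X

end Interpretation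

/-! ## Tracial W*-algebras -/

section VonNeumann

variable {H : Type u} [NormedAddCommGroup H] [InnerProductSpace ℂ H] [CompleteSpace H]

/-- The W*-algebra `W*(S)` generated by a set `S` of operators: the double commutant of `S ∪ S*`.
By `vnGenerated_le_iff`, it is the least von Neumann algebra that contains `S`. -/
def vnGenerated (S : Set (H →L[ℂ] H)) : VonNeumannAlgebra H where
  toStarSubalgebra :=
    StarSubalgebra.centralizer ℂ (StarSubalgebra.centralizer ℂ S : Set (H →L[ℂ] H))
  centralizer_centralizer' := by
    simp [Set.centralizer_centralizer_centralizer]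

theorem vnGenerated_le_iff (S : Set (H →L[ℂ] H)) (P : VonNeumannAlgebra H) :
    vnGenerated S ≤ P ↔ S ⊆ (P : Set (H →L[ℂ] H)) := by
  constructor
  · intro h x hx
    refine h ?_
    change x ∈ StarSubalgebra.centralizer ℂ (StarSubalgebra.centralizer ℂ S : Set (H →L[ℂ] H))
    rw [StarSubalgebra.mem_centralizer_iff]
    intro g hg
    have hg' := (StarSubalgebra.mem_centralizer_iff ℂ).1 hg x hx
    refine ⟨hg'.1.symm, ?_⟩
    have h2 := congrArg star hg'.2
    simpa using h2
  · intro h x hx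
    have hx' : x ∈ StarSubalgebra.centralizer ℂ
        (StarSubalgebra.centralizer ℂ S : Set (H →L[ℂ] H)) := hx
    rw [StarSubalgebra.mem_centralizer_iff] at hx'
    rw [← P.commutant_commutant, VonNeumannAlgebra.mem_commutant_iff]
    intro g hg
    refine (hx' g ?_).1
    refine (StarSubalgebra.mem_centralizer_iff ℂ).2 fun a ha => ?_
    rw [VonNeumannAlgebra.mem_commutant_iff] at hg
    exact ⟨hg a (h ha), hg _ (star_mem (h ha))⟩

end VonNeumann

/-- A tracial W*-algebra: a von Neumann algebra `M` acting on `H`, with a faithful normal tracial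
state. Normality is continuity for the weak-star (that is, ultraweak) topology: the ultraweakly
continuous functionals on `M` are the functionals `x ↦ ∑ ⟨ξ_i, x η_i⟩` with `∑ ‖ξ_i‖² < ∞` and
`∑ ‖η_i‖² < ∞`. -/
structure TracialVNAlgebra (H : Type u) [NormedAddCommGroup H] [InnerProductSpace ℂ H]
    [CompleteSpace H] extends VonNeumannAlgebra H where
  trace : toStarSubalgebra →ₗ[ℂ] ℂ
  trace_nonneg : ∀ x, 0 ≤ trace (star x * x)
  trace_one : trace 1 = 1
  trace_mul_comm : ∀ x y, trace (x * y) = trace (y * x)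
  trace_faithful : ∀ x, trace (star x * x) = 0 → x = 0
  trace_normal : ∃ ξ η : ℕ → H, Summable (fun i => ‖ξ i‖ ^ 2) ∧ Summable (fun i => ‖η i‖ ^ 2) ∧
    ∀ x : toStarSubalgebra, HasSum (fun i => inner ℂ (ξ i) ((x : H →L[ℂ] H) (η i))) (trace x)

namespace TracialVNAlgebra

variable {H : Type u} [NormedAddCommGroup H] [InnerProductSpace ℂ H] [CompleteSpace H]

/-- The elements of `M`, with the operator norm. -/
abbrev Elt (M : TracialVNAlgebra H) : Type u := M.toStarSubalgebra

/-- A W*-subalgebra `P` of `M`, with the restricted trace, is a tracial W*-algebra. -/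
def restrict (M : TracialVNAlgebra H) (P : VonNeumannAlgebra H)
    (h : P.toStarSubalgebra ≤ M.toStarSubalgebra) : TracialVNAlgebra H where
  toVonNeumannAlgebra := P
  trace := M.trace ∘ₗ (StarSubalgebra.inclusion h).toAlgHom.toLinearMap
  trace_nonneg x := M.trace_nonneg (StarSubalgebra.inclusion h x)
  trace_one := M.trace_one
  trace_mul_comm x y :=
    M.trace_mul_comm (StarSubalgebra.inclusion h x) (StarSubalgebra.inclusion h y)
  trace_faithful x hx := by
    have h1 : StarSubalgebra.inclusion h x = 0 :=
      M.trace_faithful (StarSubalgebra.inclusion h x) hx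
    exact Subtype.ext (congrArg (fun y : M.toStarSubalgebra => (y : H →L[ℂ] H)) h1)
  trace_normal := by
    obtain ⟨ξ, η, hξ, hη, hs⟩ := M.trace_normal
    exact ⟨ξ, η, hξ, hη, fun x => hs (StarSubalgebra.inclusion h x)⟩

/-- The set of operators in a tuple `X` from `M`. -/
def opRange (M : TracialVNAlgebra H) {I : Type v} (X : I → M.Elt) : Set (H →L[ℂ] H) :=
  Set.range fun i => (X i : H →L[ℂ] H)

/-- `W*(X)` for a tuple `X` from `M`. -/
def wstar (M : TracialVNAlgebra H) {I : Type v} (X : I → M.Elt) : VonNeumannAlgebra H :=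
  vnGenerated (M.opRange X)

theorem wstar_le (M : TracialVNAlgebra H) {I : Type v} (X : I → M.Elt) :
    (M.wstar X).toStarSubalgebra ≤ M.toStarSubalgebra :=
  (vnGenerated_le_iff _ M.toVonNeumannAlgebra).2 (by rintro _ ⟨i, rfl⟩; exact (X i).2)

theorem wstar_le_wstar_sumElim (M : TracialVNAlgebra H) {I : Type v} {J : Type w} (X : I → M.Elt)
    (Y : J → M.Elt) :
    (M.wstar X).toStarSubalgebra ≤ (M.wstar (Sum.elim X Y)).toStarSubalgebra :=
  (vnGenerated_le_iff _ (M.wstar (Sum.elim X Y))).2 <| by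
    rintro _ ⟨i, rfl⟩
    exact (vnGenerated_le_iff _ _).1 (le_refl (M.wstar (Sum.elim X Y))) ⟨Sum.inl i, rfl⟩

end TracialVNAlgebra

/-! ## Type spaces, over all tracial W*-algebras on Hilbert spaces in the universe `u` -/

/-- The set of quantifier-free types of tuples from `∏_j D_{r_j}`. Its topology is the weak-star
topology, induced by the product topology of `QFFormula V → ℝ`. -/
def qfTypes {V : Type v} (r : V → ℝ) : Set (QFFormula V → ℝ) :=
  {μ | ∃ (H : Type u) (_ : NormedAddCommGroup H) (_ : InnerProductSpace ℂ H)
    (_ : CompleteSpace H) (M : TracialVNAlgebra H) (X : V → M.Elt),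
    X ∈ ballProd r ∧ qfType M.trace X = μ}

/-- The set of existential types of `ℕ`-tuples from `∏_j D_{r_j}`. -/
def exTypesBdd (r : ℕ → ℝ) : Set (ExFormula ℕ → ℝ) :=
  {μ | ∃ (H : Type u) (_ : NormedAddCommGroup H) (_ : InnerProductSpace ℂ H)
    (_ : CompleteSpace H) (M : TracialVNAlgebra H) (X : ℕ → M.Elt),
    X ∈ ballProd r ∧ exType M.trace X = μ}

/-- The set of existential types of `ℕ`-tuples. -/
def exTypes : Set (ExFormula ℕ → ℝ) :=
  {μ | ∃ (H : Type u) (_ : NormedAddCommGroup H) (_ : InnerProductSpace ℂ H)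
    (_ : CompleteSpace H) (M : TracialVNAlgebra H) (X : ℕ → M.Elt), exType M.trace X = μ}

/-- Open subsets of `exTypesBdd r`. -/
def IsExOpenBdd (r : ℕ → ℝ) (O : Set (ExFormula ℕ → ℝ)) : Prop :=
  O ⊆ exTypesBdd.{u} r ∧ ∀ μ ∈ O, ∃ (k : ℕ) (φ : Fin k → ExFormula ℕ) (ε : Fin k → ℝ),
    (∀ j, 0 < ε j) ∧ {ν ∈ exTypesBdd.{u} r | ∀ j, ν (φ j) < μ (φ j) + ε j} ⊆ O

/-- Open subsets of the space `exTypes` of existential types. -/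
def IsExOpen (O : Set (ExFormula ℕ → ℝ)) : Prop :=
  O ⊆ exTypes.{u} ∧ ∀ r : ℕ → ℝ, (∀ j, 0 < r j) → IsExOpenBdd.{u} r (O ∩ exTypesBdd.{u} r)

/-! ## Matrix microstates and orbital covering numbers -/

/-- The algebra `M_n(ℂ)`, with its operator norm. -/
abbrev Mat (n : ℕ) : Type := Matrix (Fin n) (Fin n) ℂ

/-- The normalized trace on `M_n(ℂ)`. -/
def matTr (n : ℕ) (A : Mat n) : ℂ := (n : ℂ)⁻¹ * A.trace

/-- The microstate space `Γ_r^{(n)}(O)` of a set of quantifier-free types. -/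
def qfMicrostates {V : Type v} (r : V → ℝ) (n : ℕ) (O : Set (QFFormula V → ℝ)) :
    Set (V → Mat n) :=
  {X | X ∈ ballProd r ∧ qfType (matTr n) X ∈ O}

/-- The microstate space `Γ_r^{(n)}(O)` of a set of existential types. -/
def exMicrostates (r : ℕ → ℝ) (n : ℕ) (O : Set (ExFormula ℕ → ℝ)) : Set (ℕ → Mat n) :=
  {X | X ∈ ballProd r ∧ exType (matTr n) X ∈ O}

/-- The orbital neighbourhood `N^orb_{F,ε}(Ω)`. -/
def orbNbhd {V : Type v} {n : ℕ} (F : Finset V) (ε : ℝ) (Ω : Set (V → Mat n)) :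
    Set (V → Mat n) :=
  {Y | ∃ W ∈ Matrix.unitaryGroup (Fin n) ℂ, ∃ X ∈ Ω,
    ∀ i ∈ F, twoNorm (matTr n) (Y i - W * X i * star W) < ε}

/-- The orbital covering number `K^orb_{F,ε}(Ω)`. -/
def orbCov {V : Type v} {n : ℕ} (F : Finset V) (ε : ℝ) (Ω : Set (V → Mat n)) : ℕ∞ :=
  ⨅ (Ω' : Set (V → Mat n)) (_ : Ω ⊆ orbNbhd F ε Ω'), Ω'.encard

/-- `lim_{n → 𝒰} (1/n²) log K(n)`, in `[-∞, ∞]`, with `log 0 = -∞`. -/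
def growthRate (U : Ultrafilter ℕ) (K : ℕ → ℕ∞) : EReal :=
  limUnder (U : Filter ℕ) fun n =>
    ((1 / (n : ℝ) ^ 2 : ℝ) : EReal) * ENNReal.log ((K n : ℕ∞) : ℝ≥0∞)

/-- The limit along the ultrafilter in the definition of `growthRate` exists. -/
theorem tendsto_growthRate (U : Ultrafilter ℕ) (K : ℕ → ℕ∞) :
    Tendsto (fun n : ℕ => ((1 / (n : ℝ) ^ 2 : ℝ) : EReal) * ENNReal.log ((K n : ℕ∞) : ℝ≥0∞))
      (U : Filter ℕ) (𝓝 (growthRate U K)) := by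
  refine tendsto_nhds_limUnder ?_
  obtain ⟨x, -, hx⟩ := isCompact_univ.ultrafilter_le_nhds (U.map fun n : ℕ =>
    ((1 / (n : ℝ) ^ 2 : ℝ) : EReal) * ENNReal.log ((K n : ℕ∞) : ℝ≥0∞)) (by simp)
  exact ⟨x, hx⟩

/-! ## Entropies -/

/-- `Ent_{∃,r,F,ε}^𝒰(𝒦)`. -/
def exEntAux (U : Ultrafilter ℕ) (r : ℕ → ℝ) (F : Finset ℕ) (ε : ℝ)
    (K : Set (ExFormula ℕ → ℝ)) : EReal :=
  ⨅ (O : Set (ExFormula ℕ → ℝ)) (_ : IsExOpen.{u} O) (_ : K ⊆ O),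
    growthRate U fun n => orbCov F ε (exMicrostates r n O)

/-- `Ent_∃^𝒰(𝒦)`. -/
def exEnt (U : Ultrafilter ℕ) (K : Set (ExFormula ℕ → ℝ)) : EReal :=
  ⨆ (r : ℕ → ℝ) (_ : ∀ j, 0 < r j) (F : Finset ℕ) (ε : ℝ) (_ : 0 < ε), exEntAux.{u} U r F ε K

section

variable {H : Type u} [NormedAddCommGroup H] [InnerProductSpace ℂ H] [CompleteSpace H]

/-- The existential covering entropy `Ent_∃^𝒰(N : M)` of a W*-subalgebra `N ⊆ M`. -/
def existentialEntropy (U : Ultrafilter ℕ) (M : TracialVNAlgebra H) (N : VonNeumannAlgebra H)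
    (h : N.toStarSubalgebra ≤ M.toStarSubalgebra) : EReal :=
  ⨆ Z : ℕ → N.toStarSubalgebra,
    exEnt.{u} U {exType M.trace (fun k => StarSubalgebra.inclusion h (Z k))}

/-- The 1-bounded entropy `h_{r,r'}^𝒰(X : Y)` of `X` in the presence of `Y`. -/
def presenceEntropy (U : Ultrafilter ℕ) (M : TracialVNAlgebra H) {I : Type v} {J : Type w}
    (r : I → ℝ) (r' : J → ℝ) (X : I → M.Elt) (Y : J → M.Elt) : EReal :=
  ⨆ (ε : ℝ) (_ : 0 < ε) (F : Finset I),
    ⨅ (O : Set (QFFormula (I ⊕ J) → ℝ)) (_ : O ⊆ qfTypes.{u} (Sum.elim r r'))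
      (_ : O ∈ 𝓝[qfTypes.{u} (Sum.elim r r')] (qfType M.trace (Sum.elim X Y))),
      growthRate U fun n =>
        orbCov F ε ((fun Z : I ⊕ J → Mat n => Z ∘ Sum.inl) ''
          qfMicrostates (Sum.elim r r') n O)

end

end

noncomputable section

/-! ## Tracial states on C*-algebras -/

/-! Both entropies are suprema over covering scales of infima over neighbourhoods of a type. It
therefore suffices to find, for each scale on one side, a scale on the other side such that every
neighbourhood there dominates some neighbourhood here. Put N = W*(X, Y).

For ≤ (`exists_qf_nhds_orbCov_le`), let Z list the X_i with i in F, padded by zeros. An existential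
neighbourhood of the type of Z contains one cut out by finitely many bounds φ_j < c_j. Since (X, Y)
generates N, near-optimal witnesses of the infima in φ_j can be taken to be values σ(X, Y) of terms
that respect the prescribed radii in every nontrivial C*-algebra. Substituting these terms leaves
quantifier-free bounds. A matrix tuple satisfying them supplies its own witnesses σ(X', Y'), so its
first part is an existential microstate.

For ≥ (`exists_ex_nhds_orbCov_le`), approximate the entries of Z in W*(X) by terms p_k(X) in 2-norm.
One existential formula says that some (X', Y') has nearly the type of (X, Y) and satisfies Z'_k ≈
p_k(X'). The terms p_k commute with unitary conjugation and are uniformly 2-norm continuous on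
balls, so a covering of the X' by orbits is carried to a covering of the Z'. If Z violates the radii
t, then some neighbourhood has no microstates at all.

The analytic input is Kaplansky density for terms (`exists_term_norm_le`): the double commutant
argument in an amplification gives 2-norm density, and a polynomial truncation restores the norm
bound. The estimates of `QFFormula.controlled`, uniform over tracial C*-algebras, turn 2-norm
approximation into approximation of formulas. -/

/-- A tracial state on a C*-algebra. -/
structure IsTracialState {A : Type*} [CStarAlgebra A] (τ : A → ℂ) : Prop where
  map_add : ∀ x y, τ (x + y) = τ x + τ y
  map_smul : ∀ (c : ℂ) x, τ (c • x) = c * τ x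
  nonneg : ∀ x, 0 ≤ τ (star x * x)
  map_one : τ 1 = 1
  map_mul_comm : ∀ x y, τ (x * y) = τ (y * x)

namespace IsTracialState

variable {A : Type*} [CStarAlgebra A] {τ : A → ℂ}

/-- A tracial state as a linear map. -/
def toLinearMap (h : IsTracialState τ) : A →ₗ[ℂ] ℂ where
  toFun := τ
  map_add' := h.map_add
  map_smul' := h.map_smul

theorem map_zero (h : IsTracialState τ) : τ 0 = 0 := h.toLinearMap.map_zero

theorem map_sub (h : IsTracialState τ) (x y : A) : τ (x - y) = τ x - τ y :=
  h.toLinearMap.map_sub x y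

/-- A tracial state as a positive linear map. -/
theorem exists_positiveLinearMap (h : IsTracialState τ) [PartialOrder A] [StarOrderedRing A] :
    ∃ f : A →ₚ[ℂ] ℂ, ∀ x, f x = τ x :=
  ⟨PositiveLinearMap.mk₀ h.toLinearMap fun a ha => by
    obtain ⟨b, rfl⟩ := CStarAlgebra.nonneg_iff_eq_star_mul_self.1 ha
    exact h.nonneg b, fun _ => rfl⟩

theorem map_star (h : IsTracialState τ) (x : A) : τ (star x) = star (τ x) := by
  let _ := CStarAlgebra.spectralOrder A
  have := CStarAlgebra.spectralOrderedRing A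
  obtain ⟨f, hf⟩ := h.exists_positiveLinearMap
  simp only [← hf]
  exact StarHomClass.map_star f x

theorem twoNorm_sq (h : IsTracialState τ) (x : A) : twoNorm τ x ^ 2 = (τ (star x * x)).re :=
  Real.sq_sqrt (Complex.le_def.1 (h.nonneg x)).1

theorem re_sq (h : IsTracialState τ) (x : A) : ((twoNorm τ x ^ 2 : ℝ) : ℂ) = τ (star x * x) := by
  rw [h.twoNorm_sq]
  have := (Complex.le_def.1 (h.nonneg x)).2
  apply Complex.ext <;> simp_all

end IsTracialState

theorem twoNorm_nonneg {A : Type*} [Ring A] [StarRing A] (τ : A → ℂ) (x : A) : 0 ≤ twoNorm τ x :=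
  Real.sqrt_nonneg _

namespace IsTracialState

variable {A : Type*} [CStarAlgebra A] {τ : A → ℂ}

theorem twoNorm_zero (h : IsTracialState τ) : twoNorm τ (0 : A) = 0 := by
  simp [twoNorm, h.map_zero]

theorem twoNorm_star (h : IsTracialState τ) (x : A) : twoNorm τ (star x) = twoNorm τ x := by
  simp only [twoNorm, star_star, h.map_mul_comm x (star x)]

theorem twoNorm_neg (x : A) : twoNorm τ (-x) = twoNorm τ x := by
  simp [twoNorm]

theorem twoNorm_sub_comm (x y : A) : twoNorm τ (x - y) = twoNorm τ (y - x) := by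
  rw [← twoNorm_neg, neg_sub]

/-- The 2-norm is the seminorm of the GNS pre-Hilbert space of τ. The same space yields
Cauchy-Schwarz and the bound for left multiplication below. -/
theorem twoNorm_add_le (h : IsTracialState τ) (x y : A) :
    twoNorm τ (x + y) ≤ twoNorm τ x + twoNorm τ y := by
  let _ := CStarAlgebra.spectralOrder A
  have := CStarAlgebra.spectralOrderedRing A
  obtain ⟨f, hf⟩ := h.exists_positiveLinearMap
  have := norm_add_le (f.toPreGNS x) (f.toPreGNS y)
  simp only [PositiveLinearMap.preGNS_norm_def, hf, ← _root_.map_add,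
    PositiveLinearMap.ofPreGNS_toPreGNS] at this
  exact this

theorem norm_apply_star_mul_le (h : IsTracialState τ) (x y : A) :
    ‖τ (star x * y)‖ ≤ twoNorm τ x * twoNorm τ y := by
  let _ := CStarAlgebra.spectralOrder A
  have := CStarAlgebra.spectralOrderedRing A
  obtain ⟨f, hf⟩ := h.exists_positiveLinearMap
  have := norm_inner_le_norm (𝕜 := ℂ) (f.toPreGNS x) (f.toPreGNS y)
  simp only [PositiveLinearMap.preGNS_norm_def, PositiveLinearMap.preGNS_inner_def, hf,
    PositiveLinearMap.ofPreGNS_toPreGNS] at this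
  exact this

theorem twoNorm_sub_le (h : IsTracialState τ) (x y z : A) :
    twoNorm τ (x - z) ≤ twoNorm τ (x - y) + twoNorm τ (y - z) := by
  simpa using h.twoNorm_add_le (x - y) (y - z)

theorem twoNorm_smul (h : IsTracialState τ) (c : ℂ) (x : A) :
    twoNorm τ (c • x) = ‖c‖ * twoNorm τ x := by
  have h1 : twoNorm τ (c • x) ^ 2 = (‖c‖ * twoNorm τ x) ^ 2 := by
    rw [mul_pow, ← Complex.ofReal_inj, h.re_sq, Complex.ofReal_mul, h.re_sq]
    simp only [star_smul, smul_mul_assoc, mul_smul_comm, h.map_smul]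
    rw [← mul_assoc]
    simp [Complex.mul_conj, Complex.normSq_eq_norm_sq]
  exact (pow_left_inj₀ (twoNorm_nonneg _ _)
    (mul_nonneg (norm_nonneg _) (twoNorm_nonneg _ _)) two_ne_zero).1 h1

theorem twoNorm_mul_le (h : IsTracialState τ) (x y : A) :
    twoNorm τ (x * y) ≤ ‖x‖ * twoNorm τ y := by
  let _ := CStarAlgebra.spectralOrder A
  have := CStarAlgebra.spectralOrderedRing A
  obtain ⟨f, hf⟩ := h.exists_positiveLinearMap
  have h2 : ‖f.leftMulMapPreGNS x‖ ≤ ‖x‖ := LinearMap.mkContinuous_norm_le _ (norm_nonneg _) _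
  have := (f.leftMulMapPreGNS x).le_of_opNorm_le h2 (f.toPreGNS y)
  simp only [PositiveLinearMap.preGNS_norm_def, hf,
    PositiveLinearMap.leftMulMapPreGNS_apply, PositiveLinearMap.ofPreGNS_toPreGNS] at this
  exact this

/-- Traciality makes the adjoint a 2-norm isometry, which exchanges left and right multiplication.
Having both bounds makes products 2-norm continuous on operator-norm balls. -/
theorem twoNorm_mul_le' (h : IsTracialState τ) (x y : A) :
    twoNorm τ (x * y) ≤ twoNorm τ x * ‖y‖ := by
  rw [← h.twoNorm_star, star_mul, ← h.twoNorm_star x, mul_comm, ← norm_star y]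
  exact h.twoNorm_mul_le _ _

theorem twoNorm_one (h : IsTracialState τ) : twoNorm τ (1 : A) = 1 := by
  simp [twoNorm, h.map_one]

theorem twoNorm_le_norm (h : IsTracialState τ) (x : A) : twoNorm τ x ≤ ‖x‖ := by
  simpa [h.twoNorm_one] using h.twoNorm_mul_le x 1

theorem norm_apply_le (h : IsTracialState τ) (x : A) : ‖τ x‖ ≤ twoNorm τ x := by
  simpa [h.twoNorm_one] using h.norm_apply_star_mul_le 1 x

theorem twoNorm_unitary_conj (h : IsTracialState τ) {W : A} (hW : W ∈ unitary A) (x : A) :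
    twoNorm τ (W * x * star W) = twoNorm τ x := by
  have h1 : star (W * x * star W) * (W * x * star W) = W * (star x * x * star W) := by
    rw [star_mul, star_mul, star_star]
    calc W * (star x * star W) * (W * x * star W)
        = W * star x * (star W * W) * x * star W := by simp only [mul_assoc]
      _ = _ := by rw [Unitary.star_mul_self_of_mem hW]; simp only [mul_assoc, mul_one]
  rw [twoNorm, h1, h.map_mul_comm, mul_assoc, Unitary.star_mul_self_of_mem hW, mul_one, twoNorm]

end IsTracialState

/-! ## The tracial algebras of the statement -/

section VN

variable {H : Type u} [NormedAddCommGroup H] [InnerProductSpace ℂ H] [CompleteSpace H]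

theorem VonNeumannAlgebra.isClosed_coe (P : VonNeumannAlgebra H) :
    IsClosed (P.toStarSubalgebra : Set (H →L[ℂ] H)) := by
  have := P.centralizer_centralizer
  have h2 : (P.toStarSubalgebra : Set (H →L[ℂ] H)) = (P : Set (H →L[ℂ] H)) := rfl
  rw [h2, ← this]
  exact Set.isClosed_centralizer _

instance VonNeumannAlgebra.instCStarAlgebra (P : VonNeumannAlgebra H) :
    CStarAlgebra P.toStarSubalgebra :=
  StarSubalgebra.cstarAlgebra P.toStarSubalgebra (h_closed := P.isClosed_coe)

theorem TracialVNAlgebra.isTracialState (M : TracialVNAlgebra H) :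
    IsTracialState (A := M.Elt) M.trace where
  map_add := M.trace.map_add
  map_smul := M.trace.map_smul
  nonneg := M.trace_nonneg
  map_one := M.trace_one
  map_mul_comm := M.trace_mul_comm

end VN

theorem matTr_isTracialState {n : ℕ} (hn : n ≠ 0) : IsTracialState (matTr n) where
  map_add x y := by simp [matTr, Matrix.trace_add, mul_add]
  map_smul c x := by simp [matTr, Matrix.trace_smul]; ring
  nonneg x := by
    have h1 := (Matrix.posSemidef_conjTranspose_mul_self x).trace_nonneg
    have h2 : (0 : ℂ) ≤ (n : ℂ)⁻¹ := by
      rw [← Complex.ofReal_natCast, ← Complex.ofReal_inv]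
      exact Complex.zero_le_real.2 (by positivity)
    exact mul_nonneg h2 h1
  map_one := by simp [matTr, hn]
  map_mul_comm x y := by simp [matTr, Matrix.trace_mul_comm x y]

/-! ## Terms and formulas -/

section Substitution

variable {V : Type v} {W : Type w}

/-- Substitution of terms for the variables of a term. -/
def TrTerm.subst (σ : V → TrTerm W) : TrTerm V → TrTerm W
  | .var i => σ i
  | .zero => .zero
  | .one => .one
  | .add s t => .add (s.subst σ) (t.subst σ)
  | .mul s t => .mul (s.subst σ) (t.subst σ)
  | .adj t => .adj (t.subst σ)
  | .scal c t => .scal c (t.subst σ)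
  | .poly p t => .poly p fun i => (t i).subst σ

/-- Substitution of terms for the variables of a quantifier-free formula. -/
def QFFormula.subst (σ : V → TrTerm W) : QFFormula V → QFFormula W
  | .dist s t => .dist (s.subst σ) (t.subst σ)
  | .reTr t => .reTr (t.subst σ)
  | .imTr t => .imTr (t.subst σ)
  | .conn F φ => .conn F fun i => (φ i).subst σ

theorem TrTerm.eval_subst {A : Type*} [Ring A] [StarRing A] [Algebra ℂ A] (σ : V → TrTerm W)
    (X : W → A) (t : TrTerm V) : (t.subst σ).eval X = t.eval fun v => (σ v).eval X := by
  induction t <;> simp_all [TrTerm.subst, TrTerm.eval]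

theorem QFFormula.eval_subst {A : Type*} [Ring A] [StarRing A] [Algebra ℂ A] (τ : A → ℂ)
    (σ : V → TrTerm W) (X : W → A) (ψ : QFFormula V) :
    (ψ.subst σ).eval τ X = ψ.eval τ fun v => (σ v).eval X := by
  induction ψ <;> simp_all [QFFormula.subst, QFFormula.eval, TrTerm.eval_subst]

theorem TrTerm.eval_map {A B : Type*} [Ring A] [StarRing A] [Algebra ℂ A] [Ring B] [StarRing B]
    [Algebra ℂ B] (f : A →⋆ₐ[ℂ] B) (X : V → A) (t : TrTerm V) :
    t.eval (fun v => f (X v)) = f (t.eval X) := by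
  induction t with
  | poly p t ih =>
    simp only [TrTerm.eval, ih]
    have : (FreeAlgebra.lift ℂ fun i => f ((t i).eval X)) =
        (f : A →ₐ[ℂ] B).comp (FreeAlgebra.lift ℂ fun i => (t i).eval X) := by
      ext i; simp
    rw [this]; rfl
  | _ => simp_all [TrTerm.eval, map_star]

theorem twoNorm_map {A B : Type*} [Ring A] [StarRing A] [Algebra ℂ A] [Ring B] [StarRing B]
    [Algebra ℂ B] (f : A →⋆ₐ[ℂ] B) {τ : A → ℂ} {τ' : B → ℂ} (hf : ∀ a, τ' (f a) = τ a) (a : A) :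
    twoNorm τ' (f a) = twoNorm τ a := by
  rw [twoNorm, twoNorm, ← map_star, ← map_mul, hf]

theorem QFFormula.eval_map {A B : Type*} [Ring A] [StarRing A] [Algebra ℂ A] [Ring B] [StarRing B]
    [Algebra ℂ B] (f : A →⋆ₐ[ℂ] B) {τ : A → ℂ} {τ' : B → ℂ} (hf : ∀ a, τ' (f a) = τ a)
    (X : V → A) (ψ : QFFormula V) : ψ.eval τ' (fun v => f (X v)) = ψ.eval τ X := by
  induction ψ with
  | dist s t => simp only [QFFormula.eval, TrTerm.eval_map, ← map_sub, twoNorm_map f hf]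
  | reTr t => simp only [QFFormula.eval, TrTerm.eval_map, hf]
  | imTr t => simp only [QFFormula.eval, TrTerm.eval_map, hf]
  | conn F φ ih => simp only [QFFormula.eval, ih]

/-- The term `q(t)` for a one-variable polynomial `q`. -/
def TrTerm.polyAt (q : Polynomial ℂ) (t : TrTerm V) : TrTerm V :=
  .poly (Polynomial.aeval (FreeAlgebra.ι ℂ (0 : Fin 1)) q) fun _ => t

theorem TrTerm.eval_polyAt {A : Type*} [Ring A] [StarRing A] [Algebra ℂ A] (q : Polynomial ℂ)
    (X : V → A) (t : TrTerm V) : (t.polyAt q).eval X = Polynomial.aeval (t.eval X) q := by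
  simp only [TrTerm.polyAt, TrTerm.eval]
  rw [← Polynomial.aeval_algHom_apply]
  simp

end Substitution

/-! ## Bounds and moduli of continuity -/

section Modulus

variable {V : Type v}

/-- A construction of an element from a tuple in `∏_v D_{r_v}` is controlled if its norm is bounded
and if it has a modulus of continuity for the 2-norm, both uniform over all tracial C*-algebras,
where the modulus involves finitely many coordinates. -/
def Controlled (r : V → ℝ) (f : ∀ (A : Type u) [CStarAlgebra A], (V → A) → A) : Prop :=
  ∃ (B : ℝ) (G : Finset V), 0 ≤ B ∧
    (∀ (A : Type u) [CStarAlgebra A] [Nontrivial A] (X : V → A), X ∈ ballProd r → ‖f A X‖ ≤ B) ∧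
    ∀ η > 0, ∀ᶠ δ in 𝓝[>] (0 : ℝ), ∀ (A : Type u) [CStarAlgebra A] [Nontrivial A] (τ : A → ℂ),
      IsTracialState τ → ∀ X ∈ ballProd r, ∀ X' ∈ ballProd r,
      (∀ i ∈ G, twoNorm τ (X i - X' i) ≤ δ) → twoNorm τ (f A X - f A X') ≤ η

variable {r : V → ℝ} {f g : ∀ (A : Type u) [CStarAlgebra A], (V → A) → A}

theorem Controlled.var (i : V) : Controlled.{u} r fun _ _ X => X i := by
  refine ⟨|r i|, {i}, abs_nonneg _, fun _ _ _ X hX => (hX i).trans (le_abs_self _), ?_⟩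
  intro η hη
  have : ∀ᶠ δ in 𝓝[>] (0 : ℝ), δ < η := eventually_nhdsWithin_of_eventually_nhds (eventually_lt_nhds hη)
  filter_upwards [this] with δ hδ A _ _ τ hτ X hX X' hX' h
  exact (h i (by simp)).trans hδ.le

theorem Controlled.const (c : ℂ) : Controlled.{u} r fun A _ _ => c • (1 : A) := by
  refine ⟨‖c‖, ∅, norm_nonneg _, fun _ _ _ X hX => ?_, ?_⟩
  · simp [norm_smul]
  · intro η hη
    filter_upwards with δ A _ _ τ hτ X hX X' hX' h
    simpa [hτ.twoNorm_zero] using hη.le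

theorem Controlled.smul (c : ℂ) (hf : Controlled.{u} r f) :
    Controlled.{u} r fun A _ X => c • f A X := by
  obtain ⟨B, G, hB, h1, h2⟩ := hf
  refine ⟨‖c‖ * B, G, by positivity, fun A _ _ X hX => ?_, fun η hη => ?_⟩
  · rw [norm_smul]; exact mul_le_mul_of_nonneg_left (h1 A X hX) (norm_nonneg _)
  · filter_upwards [h2 (η / (‖c‖ + 1)) (by positivity)] with δ hδ A _ _ τ hτ X hX X' hX' h
    rw [← smul_sub, hτ.twoNorm_smul]
    calc ‖c‖ * twoNorm τ (f A X - f A X') ≤ ‖c‖ * (η / (‖c‖ + 1)) :=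
          mul_le_mul_of_nonneg_left (hδ A τ hτ X hX X' hX' h) (norm_nonneg _)
      _ ≤ (‖c‖ + 1) * (η / (‖c‖ + 1)) := by gcongr; linarith
      _ = η := by field_simp

theorem Controlled.star (hf : Controlled.{u} r f) : Controlled.{u} r fun A _ X => star (f A X) := by
  obtain ⟨B, G, hB, h1, h2⟩ := hf
  refine ⟨B, G, hB, fun A _ _ X hX => by rw [norm_star]; exact h1 A X hX, fun η hη => ?_⟩
  filter_upwards [h2 η hη] with δ hδ A _ _ τ hτ X hX X' hX' h
  rw [← star_sub, hτ.twoNorm_star]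
  exact hδ A τ hτ X hX X' hX' h

theorem Controlled.add (hf : Controlled.{u} r f) (hg : Controlled.{u} r g) :
    Controlled.{u} r fun A _ X => f A X + g A X := by
  classical
  obtain ⟨B, G, hB, h1, h2⟩ := hf
  obtain ⟨B', G', hB', h1', h2'⟩ := hg
  refine ⟨B + B', G ∪ G', by positivity,
    fun A _ _ X hX => (norm_add_le _ _).trans (add_le_add (h1 A X hX) (h1' A X hX)), fun η hη => ?_⟩
  filter_upwards [h2 (η / 2) (by positivity), h2' (η / 2) (by positivity)]
    with δ hδ hδ' A _ _ τ hτ X hX X' hX' h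
  rw [add_sub_add_comm]
  refine (hτ.twoNorm_add_le _ _).trans ?_
  have := hδ A τ hτ X hX X' hX' fun i hi => h i (Finset.mem_union_left _ hi)
  have := hδ' A τ hτ X hX X' hX' fun i hi => h i (Finset.mem_union_right _ hi)
  linarith

theorem Controlled.sub (hf : Controlled.{u} r f) (hg : Controlled.{u} r g) :
    Controlled.{u} r fun A _ X => f A X - g A X := by
  simpa [sub_eq_add_neg] using hf.add (hg.smul (-1))

theorem Controlled.mul (hf : Controlled.{u} r f) (hg : Controlled.{u} r g) :
    Controlled.{u} r fun A _ X => f A X * g A X := by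
  classical
  obtain ⟨B, G, hB, h1, h2⟩ := hf
  obtain ⟨B', G', hB', h1', h2'⟩ := hg
  refine ⟨B * B', G ∪ G', by positivity,
    fun A _ _ X hX => (norm_mul_le _ _).trans
      (mul_le_mul (h1 A X hX) (h1' A X hX) (norm_nonneg _) hB), fun η hη => ?_⟩
  -- Each difference is multiplied by a factor of norm at most B or B'; the extra 1 keeps the
  -- denominator positive.
  filter_upwards [h2 (η / (B + B' + 1)) (by positivity), h2' (η / (B + B' + 1)) (by positivity)]
    with δ hδ hδ' A _ _ τ hτ X hX X' hX' h
  have e : f A X * g A X - f A X' * g A X' =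
      f A X * (g A X - g A X') + (f A X - f A X') * g A X' := by noncomm_ring
  rw [e]
  refine (hτ.twoNorm_add_le _ _).trans ?_
  have a1 := hδ A τ hτ X hX X' hX' fun i hi => h i (Finset.mem_union_left _ hi)
  have a2 := hδ' A τ hτ X hX X' hX' fun i hi => h i (Finset.mem_union_right _ hi)
  calc _ ≤ B * (η / (B + B' + 1)) + (η / (B + B' + 1)) * B' := by
        refine add_le_add ((hτ.twoNorm_mul_le _ _).trans ?_) ((hτ.twoNorm_mul_le' _ _).trans ?_)
        · exact mul_le_mul (h1 A X hX) a2 (twoNorm_nonneg _ _) hB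
        · exact mul_le_mul a1 (h1' A X' hX') (norm_nonneg _) (by positivity)
    _ ≤ (B + B' + 1) * (η / (B + B' + 1)) := by
        have : 0 ≤ η / (B + B' + 1) := by positivity
        nlinarith
    _ = η := by field_simp

theorem TrTerm.controlled (r : V → ℝ) (t : TrTerm V) : Controlled.{u} r fun _ _ X => t.eval X := by
  induction t with
  | var i => exact .var i
  | zero => simpa [TrTerm.eval] using Controlled.const (r := r) 0
  | one => simpa [TrTerm.eval] using Controlled.const (r := r) 1
  | add s t hs ht => exact hs.add ht
  | mul s t hs ht => exact hs.mul ht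
  | adj t ht => exact ht.star
  | scal c t ht => exact ht.smul c
  | poly p t ht =>
    simp only [TrTerm.eval]
    induction p using FreeAlgebra.induction with
    | grade0 c => simpa [Algebra.algebraMap_eq_smul_one] using Controlled.const (r := r) c
    | grade1 i => simpa using ht i
    | mul a b ha hb => simpa using ha.mul hb
    | add a b ha hb => simpa using ha.add hb

theorem TrTerm.exists_norm_bound (r : V → ℝ) (t : TrTerm V) : ∃ B : ℝ, 0 ≤ B ∧
    ∀ (A : Type u) [CStarAlgebra A] [Nontrivial A] (X : V → A), X ∈ ballProd r → ‖t.eval X‖ ≤ B := by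
  obtain ⟨B, -, h1, h2, -⟩ := t.controlled r
  exact ⟨B, h1, h2⟩

/-- Traces are 1-Lipschitz for the 2-norm, and distances vary by at most the 2-norm change of the
difference of the terms. A connective only sees values in a compact box that is the same for all
algebras, and is uniformly continuous there. -/
theorem QFFormula.controlled (r : V → ℝ) (ψ : QFFormula V) : ∃ (B : ℝ) (G : Finset V), 0 ≤ B ∧
    (∀ (A : Type u) [CStarAlgebra A] [Nontrivial A] (τ : A → ℂ), IsTracialState τ →
      ∀ X ∈ ballProd r, |ψ.eval τ X| ≤ B) ∧
    ∀ η > 0, ∀ᶠ δ in 𝓝[>] (0 : ℝ), ∀ (A : Type u) [CStarAlgebra A] [Nontrivial A] (τ : A → ℂ),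
      IsTracialState τ → ∀ X ∈ ballProd r, ∀ X' ∈ ballProd r,
      (∀ i ∈ G, twoNorm τ (X i - X' i) ≤ δ) → |ψ.eval τ X - ψ.eval τ X'| ≤ η := by
  classical
  have key : ∀ t : TrTerm V, ∀ f : ℂ → ℝ, (∀ z z', |f z - f z'| ≤ ‖z - z'‖) → (∀ z, |f z| ≤ ‖z‖) →
    ∃ (B : ℝ) (G : Finset V), 0 ≤ B ∧
    (∀ (A : Type u) [CStarAlgebra A] [Nontrivial A] (τ : A → ℂ), IsTracialState τ →
      ∀ X ∈ ballProd r, |f (τ (t.eval X))| ≤ B) ∧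
    ∀ η > 0, ∀ᶠ δ in 𝓝[>] (0 : ℝ), ∀ (A : Type u) [CStarAlgebra A] [Nontrivial A] (τ : A → ℂ),
      IsTracialState τ → ∀ X ∈ ballProd r, ∀ X' ∈ ballProd r,
      (∀ i ∈ G, twoNorm τ (X i - X' i) ≤ δ) →
        |f (τ (t.eval X)) - f (τ (t.eval X'))| ≤ η := by
    intro t f hf hf'
    obtain ⟨B, G, hB, h1, h2⟩ := t.controlled r
    refine ⟨B, G, hB, fun A _ _ τ hτ X hX => ?_, fun η hη => ?_⟩
    · exact (hf' _).trans ((hτ.norm_apply_le _).trans ((hτ.twoNorm_le_norm _).trans (h1 A X hX)))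
    · filter_upwards [h2 η hη] with δ hδ A _ _ τ hτ X hX X' hX' h
      refine (hf _ _).trans ?_
      rw [← hτ.map_sub]
      exact (hτ.norm_apply_le _).trans (hδ A τ hτ X hX X' hX' h)
  induction ψ with
  | dist s t =>
    obtain ⟨B, G, hB, h1, h2⟩ := (s.controlled r).sub (t.controlled r)
    refine ⟨B, G, hB, fun A _ _ τ hτ X hX => ?_, fun η hη => ?_⟩
    · simp only [QFFormula.eval, abs_of_nonneg (twoNorm_nonneg _ _)]
      exact (hτ.twoNorm_le_norm _).trans (h1 A X hX)
    · filter_upwards [h2 η hη] with δ hδ A _ _ τ hτ X hX X' hX' h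
      have a := hδ A τ hτ X hX X' hX' h
      simp only [QFFormula.eval]
      rw [abs_sub_le_iff]
      constructor
      · have := hτ.twoNorm_add_le (s.eval X - t.eval X - (s.eval X' - t.eval X'))
          (s.eval X' - t.eval X')
        rw [sub_add_cancel] at this
        linarith
      · have := hτ.twoNorm_add_le (s.eval X' - t.eval X' - (s.eval X - t.eval X))
          (s.eval X - t.eval X)
        rw [sub_add_cancel, IsTracialState.twoNorm_sub_comm (s.eval X' - t.eval X')] at this
        linarith
  | reTr t =>
    exact key t Complex.re (fun z z' => by simpa using Complex.abs_re_le_norm (z - z'))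
      Complex.abs_re_le_norm
  | imTr t =>
    exact key t Complex.im (fun z z' => by simpa using Complex.abs_im_le_norm (z - z'))
      Complex.abs_im_le_norm
  | @conn k F φ ih =>
    choose B G hB h1 h2 using ih
    let K : Set (Fin k → ℝ) := Set.pi Set.univ fun i => Set.Icc (-B i) (B i)
    have hK : IsCompact K := isCompact_univ_pi fun i => isCompact_Icc
    have hmem : ∀ (A : Type u) [CStarAlgebra A] [Nontrivial A] (τ : A → ℂ), IsTracialState τ →
      ∀ X ∈ ballProd r, (fun i => (φ i).eval τ X) ∈ K := fun A _ _ τ hτ X hX i _ =>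
        abs_le.1 (h1 i A τ hτ X hX)
    obtain ⟨C, hC⟩ := hK.exists_bound_of_continuousOn F.continuous.continuousOn
    refine ⟨|C|, Finset.univ.biUnion G, abs_nonneg _, fun A _ _ τ hτ X hX =>
      (hC _ (hmem A τ hτ X hX)).trans (le_abs_self _), fun η hη => ?_⟩
    have hu := hK.uniformContinuousOn_of_continuous F.continuous.continuousOn
    rw [Metric.uniformContinuousOn_iff] at hu
    obtain ⟨δ', hδ', hu⟩ := hu η hη
    have h3 : ∀ᶠ δ in 𝓝[>] (0 : ℝ), ∀ i, _ :=
      eventually_all.2 fun i => h2 i (δ' / 2) (by positivity)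
    filter_upwards [h3] with δ hδ A _ _ τ hτ X hX X' hX' h
    have := hu _ (hmem A τ hτ X hX) _ (hmem A τ hτ X' hX') (by
      refine lt_of_le_of_lt ((dist_pi_le_iff (by positivity)).2 fun i => ?_) (half_lt_self hδ')
      rw [Real.dist_eq]
      exact hδ i A τ hτ X hX X' hX' fun j hj =>
        h j (Finset.mem_biUnion.2 ⟨i, Finset.mem_univ _, hj⟩))
    rw [Real.dist_eq] at this
    exact this.le

theorem QFFormula.exists_bound (r : V → ℝ) (ψ : QFFormula V) : ∃ B : ℝ,
    ∀ (A : Type u) [CStarAlgebra A] [Nontrivial A] (τ : A → ℂ), IsTracialState τ →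
      ∀ X ∈ ballProd r, |ψ.eval τ X| ≤ B := by
  obtain ⟨B, -, -, h, -⟩ := ψ.controlled r
  exact ⟨B, h⟩

/-- Agreement on G makes the hypothesis of the modulus hold for every δ, hence the difference is at
most every η > 0. The independence of G from the algebra is what allows finitely many quantifiers to
replace an infinite tuple. -/
theorem QFFormula.exists_support (r : V → ℝ) (ψ : QFFormula V) : ∃ G : Finset V,
    ∀ (A : Type u) [CStarAlgebra A] [Nontrivial A] (τ : A → ℂ), IsTracialState τ →
      ∀ X ∈ ballProd r, ∀ X' ∈ ballProd r, (∀ i ∈ G, X i = X' i) → ψ.eval τ X = ψ.eval τ X' := by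
  obtain ⟨-, G, -, -, h⟩ := ψ.controlled r
  refine ⟨G, fun A _ _ τ hτ X hX X' hX' hG => ?_⟩
  rw [← sub_eq_zero, ← abs_nonpos_iff]
  refine le_of_forall_pos_le_add fun η hη => ?_
  obtain ⟨δ, hδ, hδ'⟩ := ((h η hη).and self_mem_nhdsWithin).exists
  rw [zero_add]
  exact hδ A τ hτ X hX X' hX' fun i hi => by
    rw [hG i hi, sub_self, hτ.twoNorm_zero]; exact le_of_lt hδ'

theorem QFFormula.tendsto_eval {A : Type u} [CStarAlgebra A] [Nontrivial A] {τ : A → ℂ}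
    (hτ : IsTracialState τ) (ψ : QFFormula V) {ι : Type*} {l : Filter ι} {x : ι → V → A} {y : V → A}
    (hx : ∀ m, x m ∈ ballProd r) (hy : y ∈ ballProd r)
    (h : ∀ i, Tendsto (fun m => twoNorm τ (x m i - y i)) l (𝓝 0)) :
    Tendsto (fun m => ψ.eval τ (x m)) l (𝓝 (ψ.eval τ y)) := by
  obtain ⟨-, G, -, -, h2⟩ := ψ.controlled r
  rw [Metric.tendsto_nhds]
  intro η hη
  obtain ⟨δ, hδ, hδ'⟩ := ((h2 (η / 2) (half_pos hη)).and self_mem_nhdsWithin).exists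
  have : ∀ᶠ m in l, ∀ i ∈ G, twoNorm τ (x m i - y i) < δ :=
    (Finset.eventually_all G).2 fun i _ => (h i).eventually (eventually_lt_nhds hδ')
  filter_upwards [this] with m hm
  rw [Real.dist_eq]
  exact (hδ A τ hτ (x m) (hx m) y hy fun i hi => (hm i hi).le).trans_lt (half_lt_self hη)

end Modulus

/-! ## Cutting an element down to a ball -/

/-- The function `t ↦ min 1 (ρ / √t)`. -/
def cutFun (ρ t : ℝ) : ℝ := ρ / max ρ (√t)

theorem continuous_cutFun {ρ : ℝ} (hρ : 0 < ρ) : Continuous (cutFun ρ) :=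
  continuous_const.div (by fun_prop) fun t => (lt_max_of_lt_left hρ).ne'

theorem cutFun_nonneg {ρ : ℝ} (hρ : 0 < ρ) (t : ℝ) : 0 ≤ cutFun ρ t :=
  div_nonneg hρ.le (hρ.le.trans (le_max_left _ _))

theorem sqrt_mul_cutFun_le {ρ : ℝ} (hρ : 0 < ρ) (t : ℝ) : √t * cutFun ρ t ≤ ρ := by
  have : 0 < max ρ (√t) := lt_max_of_lt_left hρ
  rw [cutFun, mul_div_assoc', div_le_iff₀ this, mul_comm]
  exact mul_le_mul_of_nonneg_left (le_max_right _ _) hρ.le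

/-- The polynomial `q` approximates `cutFun ρ`, in the sense that `t q(t²)` is bounded by `ρ` and
`η`-close to `t cutFun ρ (t²)` for `0 ≤ t ≤ R`. -/
def IsCutoff (ρ R η : ℝ) (q : Polynomial ℝ) : Prop :=
  ∀ t ∈ Set.Icc 0 (R ^ 2), √t * |q.eval t| ≤ ρ ∧ √t * |q.eval t - cutFun ρ t| ≤ η

/-- Weierstrass approximation is applied to (1 - κ) `cutFun` ρ rather than to `cutFun` ρ: the
shrinkage absorbs the error, so that the bound by ρ is exact. -/
theorem exists_isCutoff {ρ R η : ℝ} (hρ : 0 < ρ) (hR : 0 ≤ R) (hη : 0 < η) :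
    ∃ q, IsCutoff ρ R η q := by
  -- One κρ pays for the approximation and one for the shrinkage.
  obtain ⟨κ, hκ, hκ1, hκη⟩ : ∃ κ : ℝ, 0 < κ ∧ κ ≤ 1 ∧ 2 * κ * ρ ≤ η := by
    refine ⟨min 1 (η / (2 * ρ)), by positivity, min_le_left _ _, ?_⟩
    calc 2 * min 1 (η / (2 * ρ)) * ρ ≤ 2 * (η / (2 * ρ)) * ρ := by gcongr; exact min_le_right _ _
      _ = η := by field_simp
  have hR1 : (0 : ℝ) < R + 1 := by positivity
  obtain ⟨q, hq⟩ := exists_polynomial_near_of_continuousOn 0 (R ^ 2)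
    (fun t => (1 - κ) * cutFun ρ t) (by have := continuous_cutFun hρ; fun_prop)
    (κ * ρ / (R + 1)) (by positivity)
  refine ⟨q, fun t ht => ?_⟩
  have h1 := (hq t ht).le
  have h2 : √t ≤ R := Real.sqrt_le_iff.2 ⟨hR, ht.2⟩
  have h3 : √t * |q.eval t - (1 - κ) * cutFun ρ t| ≤ κ * ρ :=
    calc _ ≤ (R + 1) * (κ * ρ / (R + 1)) :=
          mul_le_mul (by linarith) h1 (abs_nonneg _) hR1.le
      _ = κ * ρ := by field_simp
  have h4 := sqrt_mul_cutFun_le hρ t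
  have h5 := cutFun_nonneg hρ t
  have h6 := Real.sqrt_nonneg t
  constructor
  · have : |q.eval t| ≤ |q.eval t - (1 - κ) * cutFun ρ t| + (1 - κ) * cutFun ρ t := by
      have := abs_add_le (q.eval t - (1 - κ) * cutFun ρ t) ((1 - κ) * cutFun ρ t)
      rwa [sub_add_cancel, abs_of_nonneg (mul_nonneg (by linarith) h5)] at this
    calc √t * |q.eval t| ≤ √t * (|q.eval t - (1 - κ) * cutFun ρ t| + (1 - κ) * cutFun ρ t) := by
          gcongr
      _ = √t * |q.eval t - (1 - κ) * cutFun ρ t| + (1 - κ) * (√t * cutFun ρ t) := by ring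
      _ ≤ κ * ρ + (1 - κ) * ρ := add_le_add h3 (mul_le_mul_of_nonneg_left h4 (by linarith))
      _ = ρ := by ring
  · have : |q.eval t - cutFun ρ t| ≤ |q.eval t - (1 - κ) * cutFun ρ t| + κ * cutFun ρ t := by
      have := abs_add_le (q.eval t - (1 - κ) * cutFun ρ t) (-(κ * cutFun ρ t))
      rw [abs_neg, abs_of_nonneg (mul_nonneg hκ.le h5)] at this
      have e : q.eval t - (1 - κ) * cutFun ρ t + -(κ * cutFun ρ t) = q.eval t - cutFun ρ t := by
        ring
      rwa [e] at this
    calc _ ≤ √t * (|q.eval t - (1 - κ) * cutFun ρ t| + κ * cutFun ρ t) := by gcongr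
      _ = √t * |q.eval t - (1 - κ) * cutFun ρ t| + κ * (√t * cutFun ρ t) := by ring
      _ ≤ κ * ρ + κ * ρ := add_le_add h3 (mul_le_mul_of_nonneg_left h4 hκ.le)
      _ ≤ η := by linarith

/-! ### Truncation by functional calculus -/

section CStar

variable {A : Type u} [CStarAlgebra A]

theorem spectrum_star_mul_self_subset (a : A) :
    spectrum ℝ (star a * a) ⊆ Set.Icc 0 (‖a‖ ^ 2) := by
  let _ := CStarAlgebra.spectralOrder A
  have := CStarAlgebra.spectralOrderedRing A
  intro t ht
  refine ⟨spectrum_nonneg_of_nonneg (star_mul_self_nonneg a) ht, ?_⟩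
  cases subsingleton_or_nontrivial A
  · simp [spectrum.of_subsingleton] at ht
  · have := spectrum.norm_le_norm_of_mem ht
    rw [CStarRing.norm_star_mul_self, ← sq] at this
    exact (le_abs_self t).trans this

/-- By the C*-identity, the square of the norm is that of t f(t)² evaluated at a* a, whose spectrum
lies in [0, ‖a‖²]. -/
theorem norm_mul_cfc_le (a : A) {f : ℝ → ℝ} (hf : Continuous f) {C : ℝ} (hC : 0 ≤ C)
    (h : ∀ t ∈ Set.Icc 0 (‖a‖ ^ 2), √t * |f t| ≤ C) : ‖a * cfc f (star a * a)‖ ≤ C := by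
  have hT : IsSelfAdjoint (star a * a) := .star_mul_self a
  have h1 : star (a * cfc f (star a * a)) * (a * cfc f (star a * a)) =
      cfc (fun t => f t * t * f t) (star a * a) := by
    rw [cfc_mul (fun t => f t * t) f _ (by fun_prop) (by fun_prop),
      cfc_mul f (fun t => t) _ (by fun_prop) (by fun_prop), cfc_id' ℝ (star a * a), star_mul,
      (cfc_predicate f (star a * a) : IsSelfAdjoint _).star_eq]
    simp only [mul_assoc]
  have h2 : ‖a * cfc f (star a * a)‖ ^ 2 ≤ C ^ 2 := by
    rw [sq, ← CStarRing.norm_star_mul_self, h1]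
    refine norm_cfc_le (by positivity) fun t ht => ?_
    have ht' := spectrum_star_mul_self_subset a ht
    have h3 : f t * t * f t = (√t * |f t|) ^ 2 := by
      rw [mul_pow, Real.sq_sqrt ht'.1, sq_abs]; ring
    rw [h3, Real.norm_of_nonneg (by positivity)]
    exact pow_le_pow_left₀ (by positivity) (h t ht') 2
  exact (pow_le_pow_iff_left₀ (norm_nonneg _) hC two_ne_zero).1 h2

/-- The element of the ball of radius `ρ` that is nearest to `a`. -/
def ballCut (ρ : ℝ) (a : A) : A := a * cfc (cutFun ρ) (star a * a)

theorem norm_ballCut_le {ρ : ℝ} (hρ : 0 < ρ) (a : A) : ‖ballCut ρ a‖ ≤ ρ :=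
  norm_mul_cfc_le a (continuous_cutFun hρ) hρ.le fun t _ => by
    rw [abs_of_nonneg (cutFun_nonneg hρ t)]; exact sqrt_mul_cutFun_le hρ t

theorem ballCut_eq_self {ρ : ℝ} (hρ : 0 < ρ) {a : A} (ha : ‖a‖ ≤ ρ) : ballCut ρ a = a := by
  have h1 : cfc (cutFun ρ) (star a * a) = cfc (fun _ => (1 : ℝ)) (star a * a) := by
    refine cfc_congr fun t ht => ?_
    have h2 := (spectrum_star_mul_self_subset a ht).2
    have h3 : √t ≤ ρ :=
      Real.sqrt_le_iff.2 ⟨hρ.le, h2.trans (pow_le_pow_left₀ (norm_nonneg _) ha 2)⟩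
    simp only [cutFun, max_eq_left h3, div_self hρ.ne']
  rw [ballCut, h1, cfc_const_one ℝ (star a * a) (.star_mul_self a), mul_one]

/-- The polynomial `a q(a* a)`. -/
def polyCut (q : Polynomial ℝ) (a : A) : A := a * Polynomial.aeval (star a * a) q

theorem polyCut_eq (q : Polynomial ℝ) (a : A) :
    polyCut q a = a * cfc (fun t => q.eval t) (star a * a) := by
  rw [polyCut, cfc_polynomial q (star a * a) (.star_mul_self a)]

variable {ρ R η : ℝ} {q : Polynomial ℝ}

theorem IsCutoff.norm_polyCut_le (hq : IsCutoff ρ R η q) (hρ : 0 < ρ) {a : A} (ha : ‖a‖ ≤ R) :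
    ‖polyCut q a‖ ≤ ρ := by
  rw [polyCut_eq]
  refine norm_mul_cfc_le a q.continuous hρ.le fun t ht => (hq t ⟨ht.1, ht.2.trans ?_⟩).1
  exact pow_le_pow_left₀ (norm_nonneg _) ha 2

theorem IsCutoff.norm_polyCut_sub_le (hq : IsCutoff ρ R η q) (hρ : 0 < ρ) (hη : 0 < η) {a : A}
    (ha : ‖a‖ ≤ R) : ‖polyCut q a - ballCut ρ a‖ ≤ η := by
  have h1 := q.continuous
  have h2 := continuous_cutFun hρ
  rw [polyCut_eq, ballCut, ← mul_sub, ← cfc_sub _ _ _ h1.continuousOn h2.continuousOn]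
  refine norm_mul_cfc_le a (h1.sub h2) hη.le fun t ht => (hq t ⟨ht.1, ht.2.trans ?_⟩).2
  exact pow_le_pow_left₀ (norm_nonneg _) ha 2

variable {τ : A → ℂ}

/-- Rotate under the trace to τ(d b d*) and apply Cauchy-Schwarz to d* and b d*. -/
theorem IsTracialState.re_apply_mul_le (hτ : IsTracialState τ) (d b : A) :
    (τ (star d * d * b)).re ≤ ‖b‖ * (τ (star d * d)).re := by
  rw [mul_assoc, hτ.map_mul_comm, ← hτ.twoNorm_sq]
  have h1 := hτ.norm_apply_star_mul_le (star d) (b * star d)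
  have h2 := hτ.twoNorm_mul_le b (star d)
  rw [star_star, ← mul_assoc, hτ.map_mul_comm, ← mul_assoc] at h1
  rw [hτ.map_mul_comm, ← mul_assoc]
  rw [hτ.twoNorm_star] at h1 h2
  refine (Complex.re_le_norm _).trans (h1.trans ?_)
  have := twoNorm_nonneg τ d
  nlinarith

theorem IsTracialState.twoNorm_sub_sq (hτ : IsTracialState τ) (x y : A) :
    twoNorm τ (x - y) ^ 2 =
      twoNorm τ x ^ 2 + twoNorm τ y ^ 2 - 2 * (τ (star y * x)).re := by
  have : τ (star x * y) = star (τ (star y * x)) := by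
    rw [← hτ.map_star, star_mul, star_star]
  rw [hτ.twoNorm_sq, hτ.twoNorm_sq, hτ.twoNorm_sq, star_sub, sub_mul, mul_sub, mul_sub,
    hτ.map_sub, hτ.map_sub, hτ.map_sub, this]
  simp only [Complex.sub_re, Complex.star_def, Complex.conj_re]
  ring

/-- This is the variational inequality for a nearest point. With g the truncation of a, one has a =
g + gc with c ≥ 0 a function of a* a, and |g| = ρ wherever c ≠ 0. Hence Re τ(c g* y) ≤ ρ² τ(c) = Re
τ(c g* g), and expanding ‖(y - g) - gc‖₂² gives the claim. Truncating an approximant therefore never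
moves it away from a point of the ball. -/
theorem IsTracialState.twoNorm_sub_ballCut_le (hτ : IsTracialState τ) (hρ : 0 < ρ) (a : A) {y : A}
    (hy : ‖y‖ ≤ ρ) : twoNorm τ (y - ballCut ρ a) ≤ twoNorm τ (y - a) := by
  let _ := CStarAlgebra.spectralOrder A
  have := CStarAlgebra.spectralOrderedRing A
  have hT : IsSelfAdjoint (star a * a) := .star_mul_self a
  set T := star a * a with hTdef
  -- This is 1 / `cutFun` ρ t - 1, which vanishes for √t ≤ ρ.
  let c : ℝ → ℝ := fun t => max ρ (√t) / ρ - 1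
  have hmax : ∀ t, 0 < max ρ (√t) := fun t => lt_max_of_lt_left hρ
  have hc : Continuous c := by fun_prop
  have hh := continuous_cutFun hρ
  have hc0 : ∀ t, 0 ≤ c t := fun t => by
    have := (one_le_div hρ).2 (le_max_left ρ (√t))
    simp only [c]; linarith
  have hsa : star (cfc (cutFun ρ) T) = cfc (cutFun ρ) T :=
    (cfc_predicate (cutFun ρ) T : IsSelfAdjoint _).star_eq
  have hsc : star (cfc c T) = cfc c T := (cfc_predicate c T : IsSelfAdjoint _).star_eq
  set g := ballCut ρ a with hg
  have e1 : a = g + g * cfc c T := by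
    rw [hg, ballCut, ← hTdef, mul_assoc, ← mul_add, ← cfc_mul _ _ _ (by fun_prop) (by fun_prop),
      ← cfc_add _ _ _ (by fun_prop) (by fun_prop)]
    have : cfc (fun t => cutFun ρ t + cutFun ρ t * c t) T = cfc (fun _ => (1 : ℝ)) T := by
      refine cfc_congr fun t _ => ?_
      simp only [cutFun, c]
      have := (hmax t).ne'
      field_simp
      ring
    rw [this, cfc_const_one ℝ T, mul_one]
  have e2 : cfc c T * (star g * g) = (ρ ^ 2) • cfc c T := by
    have : star g * g = cfc (fun t => cutFun ρ t * t * cutFun ρ t) T := by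
      rw [cfc_mul (fun t => cutFun ρ t * t) (cutFun ρ) _ (by fun_prop) (by fun_prop),
        cfc_mul (cutFun ρ) (fun t => t) _ (by fun_prop) (by fun_prop), cfc_id' ℝ T, hg, ballCut,
        star_mul, ← hTdef, hsa]
      simp only [hTdef, mul_assoc]
    rw [this, ← cfc_mul _ _ _ (by fun_prop) (by fun_prop), ← cfc_smul _ _ _ (by fun_prop)]
    refine cfc_congr fun t ht => ?_
    have ht' := (spectrum_star_mul_self_subset a ht).1
    simp only [cutFun, c, smul_eq_mul]
    rcases le_total (√t) ρ with h | h
    · simp [max_eq_left h, hρ.ne']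
    · rw [max_eq_right h]
      have h0 : 0 < √t := hρ.trans_le h
      field_simp
      rw [Real.sq_sqrt ht']
      ring
  obtain ⟨d, hd⟩ := CStarAlgebra.nonneg_iff_eq_star_mul_self.1 (cfc_nonneg (a := T) fun t _ => hc0 t)
  have e3 : (τ (cfc c T * (star g * y))).re ≤ (τ (cfc c T * (star g * g))).re := by
    have : (τ (cfc c T * (star g * g))).re = ρ ^ 2 * (τ (star d * d)).re := by
      rw [e2, ← hd, ← Complex.coe_smul, hτ.map_smul, Complex.re_ofReal_mul]
    rw [this, hd]
    refine (hτ.re_apply_mul_le d _).trans ?_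
    have h1 : ‖star g * y‖ ≤ ρ * ρ := (norm_mul_le _ _).trans
      (mul_le_mul ((norm_star g).trans_le (norm_ballCut_le hρ a)) hy (norm_nonneg _) hρ.le)
    rw [sq]
    exact mul_le_mul_of_nonneg_right h1 (Complex.le_def.1 (hτ.nonneg d)).1
  have e4 : y - a = (y - g) - g * cfc c T := by rw [sub_sub, ← e1]
  have e5 : twoNorm τ (y - a) ^ 2 = twoNorm τ (y - g) ^ 2 + twoNorm τ (g * cfc c T) ^ 2 -
      2 * (τ (star (g * cfc c T) * (y - g))).re := by
    rw [e4, hτ.twoNorm_sub_sq]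
  have e6 : (τ (star (g * cfc c T) * (y - g))).re ≤ 0 := by
    rw [star_mul, hsc, mul_assoc, mul_sub, mul_sub, hτ.map_sub, Complex.sub_re]
    linarith
  refine (pow_le_pow_iff_left₀ (twoNorm_nonneg _ _) (twoNorm_nonneg _ _) two_ne_zero).1 ?_
  nlinarith [sq_nonneg (twoNorm τ (g * cfc c T))]

theorem IsCutoff.twoNorm_sub_polyCut_le (hq : IsCutoff ρ R η q) (hτ : IsTracialState τ)
    (hρ : 0 < ρ) (hη : 0 < η) {a y : A} (ha : ‖a‖ ≤ R) (hy : ‖y‖ ≤ ρ) :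
    twoNorm τ (y - polyCut q a) ≤ twoNorm τ (y - a) + η := by
  refine (hτ.twoNorm_sub_le _ (ballCut ρ a) _).trans (add_le_add
    (hτ.twoNorm_sub_ballCut_le hρ a hy) ((hτ.twoNorm_le_norm _).trans ?_))
  rw [norm_sub_rev]
  exact hq.norm_polyCut_sub_le hρ hη ha

end CStar

/-- The term `t q(t* t)`. -/
def TrTerm.cut {V : Type v} (q : Polynomial ℝ) (t : TrTerm V) : TrTerm V :=
  .mul t (TrTerm.polyAt (q.map (algebraMap ℝ ℂ)) (.mul (.adj t) t))

theorem TrTerm.eval_cut {V : Type v} {A : Type u} [CStarAlgebra A] (q : Polynomial ℝ) (X : V → A)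
    (t : TrTerm V) : (t.cut q).eval X = polyCut q (t.eval X) := by
  simp [TrTerm.cut, TrTerm.eval, TrTerm.eval_polyAt, polyCut, Polynomial.aeval_map_algebraMap]

/-! ## Density of a *-algebra in its double commutant -/

section Bicommutant

theorem exists_comp_lp {E : Type*} [NormedAddCommGroup E] {ι ι' : Type*} {j : ι' → ι} (hj : Function.Injective j)
    (f : lp (fun _ : ι => E) 2) :
    ∃ g : lp (fun _ : ι' => E) 2, (∀ i, g i = f (j i)) ∧ ‖g‖ ≤ ‖f‖ := by
  have h2 : 0 < (2 : ℝ≥0∞).toReal := by simp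
  refine ⟨⟨fun i => f (j i), memℓp_gen (((lp.memℓp f).summable h2).comp_injective hj)⟩,
    fun i => rfl, lp.norm_le_of_forall_sum_le h2 (norm_nonneg _) fun s => ?_⟩
  have := lp.sum_rpow_le_norm_rpow h2 f (s.map ⟨j, hj⟩)
  rwa [Finset.sum_map] at this

variable {H : Type u} [NormedAddCommGroup H] [InnerProductSpace ℂ H] {ι : Type*}

/-- The diagonal action of an operator on a Hilbert sum of copies of the space. -/
def lpDiag (a : H →L[ℂ] H) : lp (fun _ : ι => H) 2 →L[ℂ] lp (fun _ : ι => H) 2 :=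
  LinearMap.mkContinuous
    { toFun := fun f => ⟨fun i => a (f i), (f.2.const_smul (‖a‖ : ℂ)).mono' fun i => by
        refine (a.le_opNorm (f i)).trans_eq ?_
        change _ = ‖(‖a‖ : ℂ) • (f i : H)‖
        rw [norm_smul]
        simp⟩
      map_add' := fun f g => by ext i; exact a.map_add _ _
      map_smul' := fun c f => by ext i; simp }
    ‖a‖ fun f => by
      have : ‖f‖ * ‖a‖ = ‖(‖a‖ : ℂ) • f‖ := by
        rw [norm_smul]; simp [mul_comm]
      rw [mul_comm, this]
      refine lp.norm_mono two_ne_zero fun i => (a.le_opNorm (f i)).trans_eq ?_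
      change _ = ‖(‖a‖ : ℂ) • (f i : H)‖
      rw [norm_smul]
      simp

@[simp]
theorem lpDiag_apply (a : H →L[ℂ] H) (f : lp (fun _ : ι => H) 2) (i : ι) :
    lpDiag a f i = a (f i) := rfl

theorem lpDiag_single [DecidableEq ι] (a : H →L[ℂ] H) (j : ι) (x : H) :
    lpDiag a (lp.single 2 j x) = lp.single 2 j (a x) := by
  ext i
  rcases eq_or_ne i j with rfl | h
  · simp
  · simp [h]

variable [CompleteSpace H]

theorem inner_lpDiag (a : H →L[ℂ] H) (f g : lp (fun _ : ι => H) 2) :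
    inner ℂ (lpDiag a f) g = inner ℂ f (lpDiag (star a) g) := by
  rw [lp.inner_eq_tsum, lp.inner_eq_tsum]
  refine tsum_congr fun i => ?_
  simp [ContinuousLinearMap.star_eq_adjoint, ContinuousLinearMap.adjoint_inner_right]

/-- The space `{a ζ : a ∈ S}` for a *-algebra `S`, acting diagonally. -/
def orbitSpace (S : StarSubalgebra ℂ (H →L[ℂ] H)) (ζ : lp (fun _ : ι => H) 2) :
    Submodule ℂ (lp (fun _ : ι => H) 2) where
  carrier := {f | ∃ a ∈ S, lpDiag a ζ = f}
  zero_mem' := ⟨0, S.zero_mem, by ext i; simp⟩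
  add_mem' := by
    rintro _ _ ⟨a, ha, rfl⟩ ⟨b, hb, rfl⟩
    exact ⟨a + b, S.add_mem ha hb, by ext i; simp⟩
  smul_mem' := by
    rintro c _ ⟨a, ha, rfl⟩
    exact ⟨c • a, S.smul_mem ha c, by ext i; simp⟩

/-- The diagonal version of von Neumann's density theorem. -/
theorem lpDiag_mem_closure_orbitSpace (S : StarSubalgebra ℂ (H →L[ℂ] H)) {x : H →L[ℂ] H}
    (hx : ∀ y : H →L[ℂ] H, (∀ a ∈ S, a * y = y * a) → x * y = y * x)
    (ζ : lp (fun _ : ι => H) 2) : lpDiag x ζ ∈ (orbitSpace S ζ).topologicalClosure := by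
  classical
  set V := (orbitSpace S ζ).topologicalClosure with hV
  have : CompleteSpace V := (orbitSpace S ζ).isClosed_topologicalClosure.completeSpace_coe
  have hinv : ∀ a ∈ S, ∀ f ∈ V, lpDiag a f ∈ V := by
    intro a ha f hf
    refine map_mem_closure (lpDiag a).continuous hf ?_
    rintro _ ⟨b, hb, rfl⟩
    exact ⟨a * b, S.mul_mem ha hb, by ext i; simp⟩
  -- Since S is closed under adjoints, the orthogonal complement of V is invariant too.
  have hcomm : ∀ a ∈ S, ∀ f, V.starProjection (lpDiag a f) = lpDiag a (V.starProjection f) := by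
    intro a ha f
    refine Submodule.eq_starProjection_of_mem_orthogonal
      (hinv a ha _ (V.starProjection_apply_mem f)) ?_
    rw [← map_sub, Submodule.mem_orthogonal']
    intro g hg
    rw [inner_lpDiag]
    exact (Submodule.mem_orthogonal' _ _).1 (V.sub_starProjection_mem_orthogonal f) _
      (hinv _ (star_mem ha) g hg)
  -- The matrix entries of the projection onto V commute with S, hence with x.
  have hxij : ∀ i j (h : H), V.starProjection (lp.single 2 j (x h)) i =
      x (V.starProjection (lp.single 2 j h) i) := by
    intro i j h
    let y : H →L[ℂ] H := (lp.evalCLM ℂ (fun _ : ι => H) 2 i) ∘L V.starProjection ∘L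
      (lp.singleContinuousLinearMap ℂ (fun _ : ι => H) 2 j)
    have h1 := hx y fun a ha => by
      ext k
      change a (V.starProjection (lp.single 2 j k) i) = V.starProjection (lp.single 2 j (a k)) i
      rw [← lpDiag_single, hcomm a ha]
      rfl
    exact (congrArg (fun z : H →L[ℂ] H => z h) h1).symm
  have hζ : V.starProjection ζ = ζ := Submodule.starProjection_eq_self_iff.2
    (subset_closure ⟨1, S.one_mem, by ext i; simp⟩)
  rw [← Submodule.starProjection_eq_self_iff]
  ext i
  -- Summing over the entries shows that the projection commutes with x at ζ; it fixes ζ, so it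
  -- fixes xζ.
  have s1 := (lp.hasSum_single (p := 2) (by simp) (lpDiag x ζ)).mapL
    ((lp.evalCLM ℂ (fun _ : ι => H) 2 i) ∘L V.starProjection)
  have s2 := (lp.hasSum_single (p := 2) (by simp) ζ).mapL
    (x ∘L (lp.evalCLM ℂ (fun _ : ι => H) 2 i) ∘L V.starProjection)
  have s3 := s1.unique (s2.congr_fun ?_)
  · have s4 : V.starProjection (lpDiag x ζ) i = x (V.starProjection ζ i) := s3
    rw [s4, hζ, lpDiag_apply]
  · intro j
    exact hxij i j (ζ j)

end Bicommutant

/-! ### Kaplansky density for terms in the 2-norm -/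

section Trace

variable {H : Type u} [NormedAddCommGroup H] [InnerProductSpace ℂ H] [CompleteSpace H]

/-- The trace norm is dominated by the norm of a vector, for the diagonal action. -/
theorem TracialVNAlgebra.exists_twoNorm_le (M : TracialVNAlgebra H) :
    ∃ ζ : lp (fun _ : ℕ ⊕ ℕ => H) 2, ∀ x : M.Elt, twoNorm M.trace x ≤ ‖lpDiag (x : H →L[ℂ] H) ζ‖ := by
  obtain ⟨ξ, η, hξ, hη, hs⟩ := M.trace_normal
  -- Both families go into one vector, so that a single norm bounds both factors in τ(x* x) = ∑ ⟨x
  -- ξ_i, x η_i⟩.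
  have hmem : Memℓp (E := fun _ : ℕ ⊕ ℕ => H) (Sum.elim ξ η) 2 := memℓp_gen (by
    simp only [ENNReal.toReal_ofNat, Real.rpow_ofNat]
    exact Summable.sum _ (by simpa [Function.comp_def] using hξ)
      (by simpa [Function.comp_def] using hη))
  set ζ : lp (fun _ : ℕ ⊕ ℕ => H) 2 := ⟨Sum.elim ξ η, hmem⟩
  refine ⟨ζ, fun x => ?_⟩
  obtain ⟨g₁, hg₁, hn₁⟩ := exists_comp_lp Sum.inl_injective (lpDiag (x : H →L[ℂ] H) ζ)
  obtain ⟨g₂, hg₂, hn₂⟩ := exists_comp_lp Sum.inr_injective (lpDiag (x : H →L[ℂ] H) ζ)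
  have h1 : M.trace (star x * x) = inner ℂ g₁ g₂ := by
    refine (hs _).unique ((lp.hasSum_inner g₁ g₂).congr_fun fun i => ?_)
    rw [hg₁, hg₂]
    change inner ℂ (ξ i) ((star (x : H →L[ℂ] H)) ((x : H →L[ℂ] H) (η i))) =
      inner ℂ ((x : H →L[ℂ] H) (ξ i)) ((x : H →L[ℂ] H) (η i))
    rw [ContinuousLinearMap.star_eq_adjoint, ContinuousLinearMap.adjoint_inner_right]
  refine Real.sqrt_le_iff.2 ⟨norm_nonneg _, ?_⟩
  rw [h1, sq]
  exact (Complex.re_le_norm _).trans ((norm_inner_le_norm _ _).trans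
    (mul_le_mul hn₁ hn₂ (norm_nonneg _) (norm_nonneg _)))

/-- The operators obtained by evaluating terms form a *-algebra. -/
def TracialVNAlgebra.termAlgebra (M : TracialVNAlgebra H) {V : Type v} (X : V → M.Elt) :
    StarSubalgebra ℂ (H →L[ℂ] H) where
  carrier := {a | ∃ t : TrTerm V, ((t.eval X : M.Elt) : H →L[ℂ] H) = a}
  mul_mem' := by rintro _ _ ⟨s, rfl⟩ ⟨t, rfl⟩; exact ⟨.mul s t, rfl⟩
  add_mem' := by rintro _ _ ⟨s, rfl⟩ ⟨t, rfl⟩; exact ⟨.add s t, rfl⟩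
  algebraMap_mem' c := ⟨.scal c .one, (Algebra.algebraMap_eq_smul_one c).symm⟩
  star_mem' := by rintro _ ⟨t, rfl⟩; exact ⟨.adj t, rfl⟩

/-- By normality, one amplified vector ζ dominates the 2-norm. The diagonal density theorem, applied
to the *-algebra of term values, approximates yζ by values of terms at X applied to ζ. -/
theorem TracialVNAlgebra.exists_term_twoNorm_lt (M : TracialVNAlgebra H) {V : Type v}
    (X : V → M.Elt) {y : M.Elt} (hy : (y : H →L[ℂ] H) ∈ M.wstar X) {δ : ℝ} (hδ : 0 < δ) :
    ∃ t : TrTerm V, twoNorm M.trace (y - t.eval X) < δ := by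
  obtain ⟨ζ, hζ⟩ := M.exists_twoNorm_le
  have hmem : lpDiag (y : H →L[ℂ] H) ζ ∈ (orbitSpace (M.termAlgebra X) ζ).topologicalClosure := by
    refine lpDiag_mem_closure_orbitSpace _ (fun z hz => ?_) ζ
    have hy' : (y : H →L[ℂ] H) ∈ StarSubalgebra.centralizer ℂ
      (StarSubalgebra.centralizer ℂ (M.opRange X) : Set (H →L[ℂ] H)) := hy
    refine ((StarSubalgebra.mem_centralizer_iff ℂ).1 hy' z ?_).1.symm
    refine (StarSubalgebra.mem_centralizer_iff ℂ).2 ?_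
    rintro _ ⟨i, rfl⟩
    exact ⟨hz _ ⟨.var i, rfl⟩, hz _ ⟨.adj (.var i), rfl⟩⟩
  obtain ⟨_, ⟨_, ⟨t, rfl⟩, rfl⟩, ht⟩ := Metric.mem_closure_iff.1 hmem δ hδ
  refine ⟨t, (hζ _).trans_lt ?_⟩
  rw [dist_eq_norm] at ht
  have e : lpDiag (y : H →L[ℂ] H) ζ - lpDiag ((t.eval X : M.Elt) : H →L[ℂ] H) ζ =
      lpDiag ((y - t.eval X : M.Elt) : H →L[ℂ] H) ζ := by
    ext i; simp
  rwa [e] at ht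

instance TracialVNAlgebra.nontrivial_elt (M : TracialVNAlgebra H) : Nontrivial M.Elt := by
  refine ⟨0, 1, fun h => ?_⟩
  have := M.trace_one
  rw [← h, map_zero] at this
  exact zero_ne_one this

/-- Elements of the ball of radius `ρ` in `W*(X)` are 2-norm limits of terms that map `∏ D_{r_i}` to
the ball of radius `ρ`, in all C*-algebras. -/
theorem TracialVNAlgebra.exists_term_norm_le (M : TracialVNAlgebra H) {V : Type v}
    {X : V → M.Elt} {r : V → ℝ} (hX : X ∈ ballProd r) {y : M.Elt}
    (hy : (y : H →L[ℂ] H) ∈ M.wstar X) {ρ : ℝ} (hρ : 0 < ρ) (hyρ : ‖y‖ ≤ ρ) {δ : ℝ} (hδ : 0 < δ) :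
    ∃ t : TrTerm V, twoNorm M.trace (y - t.eval X) < δ ∧ ‖t.eval X‖ ≤ ρ ∧
      ∀ (A : Type w) [CStarAlgebra A] [Nontrivial A] (X' : V → A), X' ∈ ballProd r →
        ‖t.eval X'‖ ≤ ρ := by
  obtain ⟨t, ht⟩ := M.exists_term_twoNorm_lt X hy (half_pos hδ)
  obtain ⟨B, hB, h1⟩ := t.exists_norm_bound.{u} r
  obtain ⟨B', hB', h2⟩ := t.exists_norm_bound.{w} r
  have hη : 0 < δ / 2 := half_pos hδ
  -- The same cutoff must serve M and all target algebras, which live in another universe; hence the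
  -- maximum of the two bounds.
  obtain ⟨q, hq⟩ := exists_isCutoff hρ (hB.trans (le_max_left B B')) hη
  have h3 : ‖t.eval X‖ ≤ max B B' := (h1 _ X hX).trans (le_max_left _ _)
  refine ⟨t.cut q, ?_, ?_, fun A _ _ X' hX' => ?_⟩
  · have := TrTerm.eval_cut q X t
    have h4 := hq.twoNorm_sub_polyCut_le M.isTracialState hρ hη h3 hyρ
    rw [← TrTerm.eval_cut q X t] at h4
    exact h4.trans_lt (by linarith)
  · have h4 := hq.norm_polyCut_le hρ h3
    rw [← TrTerm.eval_cut q X t] at h4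
    exact h4
  · rw [TrTerm.eval_cut]
    exact hq.norm_polyCut_le hρ ((h2 A X' hX').trans (le_max_right _ _))

end Trace

/-! ## Matrix algebras as tracial W*-algebras -/

section Transport

variable {A B : Type*} [CStarAlgebra A] [CStarAlgebra B] {V : Type v}

theorem QFFormula.eval_equiv (f : A ≃⋆ₐ[ℂ] B) {τ : A → ℂ} {τ' : B → ℂ} (hf : ∀ a, τ' (f a) = τ a)
    (X : V → A) (ψ : QFFormula V) : ψ.eval τ' (fun v => f (X v)) = ψ.eval τ X :=
  ψ.eval_map (f : A →⋆ₐ[ℂ] B) hf X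

/-- An isomorphism carries the quantified balls onto each other; a mere embedding would only compare
the infima in one direction. -/
theorem ExFormula.eval_equiv (f : A ≃⋆ₐ[ℂ] B) {τ : A → ℂ} {τ' : B → ℂ} (hf : ∀ a, τ' (f a) = τ a)
    (X : V → A) (φ : ExFormula V) : φ.eval τ' (fun v => f (X v)) = φ.eval τ X := by
  have key : ∀ Y : Fin φ.k → A, φ.body.eval τ' (Sum.elim (fun v => f (X v)) fun i => f (Y i)) =
      φ.body.eval τ (Sum.elim X Y) := fun Y => by
    rw [← QFFormula.eval_equiv f hf]
    congr 1
    ext (v | i) <;> rfl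
  unfold ExFormula.eval
  congr 1
  ext z
  constructor
  · rintro ⟨Y, hY, rfl⟩
    refine ⟨fun i => f.symm (Y i), fun i => ?_, ?_⟩
    · rw [StarAlgEquiv.norm_map]; exact hY i
    · simp [← key]
  · rintro ⟨Y, hY, rfl⟩
    refine ⟨fun i => f (Y i), fun i => ?_, key Y⟩
    rw [StarAlgEquiv.norm_map]; exact hY i

end Transport

section MatrixModel

/-- The Hilbert space, in an arbitrary universe, on which `M_n(ℂ)` acts. -/
abbrev MatSpace (n : ℕ) : Type u := EuclideanSpace ℂ (ULift.{u} (Fin n))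

/-- Matrices as operators. -/
def matToOp (n : ℕ) : Mat n ≃⋆ₐ[ℂ] (MatSpace.{u} n →L[ℂ] MatSpace.{u} n) :=
  (StarAlgEquiv.ofAlgEquiv (Matrix.reindexAlgEquiv ℂ ℂ (Equiv.ulift.{u} (α := Fin n)).symm)
    fun _ => rfl).trans Matrix.toEuclideanCLM

theorem inner_matToOp (n : ℕ) (A : Mat n) (i : Fin n) :
    inner ℂ (EuclideanSpace.single (ULift.up i) (1 : ℂ) : MatSpace.{u} n)
      (matToOp n A (EuclideanSpace.single (ULift.up i) 1)) = A i i := by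
  rw [EuclideanSpace.inner_single_left]
  simp [matToOp, Matrix.ofLp_toEuclideanCLM]
  rfl

/-- All operators on a Hilbert space. -/
def fullVN (H : Type u) [NormedAddCommGroup H] [InnerProductSpace ℂ H] [CompleteSpace H] :
    VonNeumannAlgebra H where
  toStarSubalgebra := ⊤
  centralizer_centralizer' := by
    simp

/-- Matrices as elements of the algebra of all operators. -/
def matToFull (n : ℕ) : Mat n ≃⋆ₐ[ℂ] (fullVN (MatSpace.{u} n)).toStarSubalgebra where
  toFun A := ⟨matToOp n A, trivial⟩
  invFun x := (matToOp n).symm x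
  left_inv A := by simp
  right_inv x := by simp
  map_mul' A B := Subtype.ext (map_mul (matToOp n) A B)
  map_add' A B := Subtype.ext (map_add (matToOp n) A B)
  map_star' A := Subtype.ext (map_star (matToOp n) A)
  map_smul' c A := Subtype.ext (map_smul (matToOp n) c A)

theorem eq_zero_of_matTr_eq_zero {n : ℕ} (hn : n ≠ 0) {A : Mat n}
    (h : matTr n (star A * A) = 0) : A = 0 := by
  have : (n : ℂ)⁻¹ ≠ 0 := by simpa using hn
  exact Matrix.trace_conjTranspose_mul_self_eq_zero_iff.1 ((mul_eq_zero.1 h).resolve_left this)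

/-- `M_n(ℂ)` as a tracial W*-algebra. -/
def matVN {n : ℕ} (hn : n ≠ 0) : TracialVNAlgebra (MatSpace.{u} n) where
  toVonNeumannAlgebra := fullVN _
  trace := (matTr_isTracialState hn).toLinearMap ∘ₗ (matToFull n).symm.toAlgEquiv.toLinearMap
  trace_nonneg x := by
    have := (matTr_isTracialState hn).nonneg ((matToFull n).symm x)
    rw [← map_star, ← map_mul] at this
    exact this
  trace_one := by
    have := (matTr_isTracialState hn).map_one
    rw [← (matToFull n).toAlgEquiv.symm.map_one] at this
    exact this
  trace_mul_comm x y := by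
    have := (matTr_isTracialState hn).map_mul_comm ((matToFull n).symm x) ((matToFull n).symm y)
    rw [← map_mul, ← map_mul] at this
    exact this
  trace_faithful x hx := by
    have : (matToFull n).symm x = 0 := eq_zero_of_matTr_eq_zero hn (by
      rw [← map_star, ← map_mul]; exact hx)
    simpa using this
  trace_normal := by
    refine ⟨fun k => if h : k < n then (n : ℂ)⁻¹ • EuclideanSpace.single ⟨k, h⟩ 1 else 0,
      fun k => if h : k < n then EuclideanSpace.single ⟨k, h⟩ 1 else 0, ?_, ?_, fun x => ?_⟩
    · exact summable_of_ne_finset_zero (s := Finset.range n) fun k hk => by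
        simp [dif_neg (mt Finset.mem_range.2 hk)]
    · exact summable_of_ne_finset_zero (s := Finset.range n) fun k hk => by
        simp [dif_neg (mt Finset.mem_range.2 hk)]
    · obtain ⟨A, rfl⟩ : ∃ A, matToFull n A = x := ⟨_, (matToFull n).apply_symm_apply x⟩
      have h1 : matTr n A = ∑ k ∈ Finset.range n, inner ℂ
          (if h : k < n then (n : ℂ)⁻¹ • EuclideanSpace.single (ULift.up ⟨k, h⟩) 1 else 0 :
            MatSpace.{u} n) (matToOp n A
          (if h : k < n then EuclideanSpace.single (ULift.up ⟨k, h⟩) 1 else 0)) := by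
        rw [Finset.sum_range, matTr, Matrix.trace, Finset.mul_sum]
        refine Finset.sum_congr rfl fun i _ => ?_
        rw [dif_pos i.2, dif_pos i.2, inner_smul_left, inner_matToOp]
        simp
      have h2 : ((matTr_isTracialState hn).toLinearMap ∘ₗ
          (matToFull n).symm.toAlgEquiv.toLinearMap) (matToFull n A) = matTr n A :=
        congrArg (matTr n) ((matToFull n).symm_apply_apply A)
      rw [h2, h1]
      refine hasSum_sum_of_ne_finset_zero fun k hk => ?_
      simp [dif_neg (mt Finset.mem_range.2 hk)]

theorem matVN_trace_matToFull {n : ℕ} (hn : n ≠ 0) (A : Mat n) :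
    (matVN.{u} hn).trace (matToFull n A) = matTr n A :=
  congrArg (matTr n) ((matToFull n).symm_apply_apply A)

variable {n : ℕ} {V : Type v}

theorem matToFull_mem_ballProd {X : V → Mat n} {r : V → ℝ} (hX : X ∈ ballProd r) :
    (fun v => matToFull.{u} n (X v)) ∈ ballProd r := fun v => by
  rw [StarAlgEquiv.norm_map]; exact hX v

theorem exType_mem_exTypesBdd (hn : n ≠ 0) {X : ℕ → Mat n} {r : ℕ → ℝ} (hX : X ∈ ballProd r) :
    exType (matTr n) X ∈ exTypesBdd.{u} r :=
  ⟨MatSpace.{u} n, inferInstance, inferInstance, inferInstance, matVN hn,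
    fun k => matToFull n (X k), matToFull_mem_ballProd hX,
    funext fun φ => φ.eval_equiv (matToFull n) (matVN_trace_matToFull hn) X⟩

theorem qfType_mem_qfTypes (hn : n ≠ 0) {X : V → Mat n} {r : V → ℝ} (hX : X ∈ ballProd r) :
    qfType (matTr n) X ∈ qfTypes.{u} r :=
  ⟨MatSpace.{u} n, inferInstance, inferInstance, inferInstance, matVN hn,
    fun k => matToFull n (X k), matToFull_mem_ballProd hX,
    funext fun ψ => ψ.eval_equiv (matToFull n) (matVN_trace_matToFull hn) X⟩

end MatrixModel

/-! ## Growth rates and covering numbers -/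

/-- The size n = 0 must be discarded because the normalized trace on the zero algebra is not a
state. -/
theorem eventually_ne_zero_of_le_cofinite {U : Ultrafilter ℕ}
    (hU : (U : Filter ℕ) ≤ Filter.cofinite) : ∀ᶠ n in (U : Filter ℕ), n ≠ 0 :=
  hU (by simp)

theorem growthRate_mono {U : Ultrafilter ℕ} {K K' : ℕ → ℕ∞}
    (h : ∀ᶠ n in (U : Filter ℕ), K n ≤ K' n) : growthRate U K ≤ growthRate U K' := by
  refine le_of_tendsto_of_tendsto (tendsto_growthRate U K) (tendsto_growthRate U K') ?_
  filter_upwards [h] with n hn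
  refine mul_le_mul_of_nonneg_left (ENNReal.log_monotone (ENat.toENNReal_mono hn)) ?_
  exact EReal.coe_nonneg.2 (by positivity)

section Covering

variable {V : Type v} {W : Type w} {n : ℕ} {F : Finset V} {F' : Finset W} {ε ε' : ℝ}
  {Ω : Set (V → Mat n)} {Ω' : Set (W → Mat n)}

theorem orbCov_le_of_forall (h : ∀ Ω₁, Ω ⊆ orbNbhd F ε Ω₁ →
    ∃ Ω₂, Ω' ⊆ orbNbhd F' ε' Ω₂ ∧ Ω₂.encard ≤ Ω₁.encard) : orbCov F' ε' Ω' ≤ orbCov F ε Ω :=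
  le_iInf₂ fun Ω₁ h₁ => by
    obtain ⟨Ω₂, h₂, h₃⟩ := h Ω₁ h₁
    exact iInf₂_le_of_le Ω₂ h₂ h₃

theorem orbCov_empty : orbCov F ε (∅ : Set (V → Mat n)) = 0 :=
  le_antisymm (iInf₂_le_of_le ∅ (Set.empty_subset _) (by simp)) bot_le

theorem orbCov_le_of_reindex (e : V → W) (he : ∀ i ∈ F, e i ∈ F')
    (h : ∀ Z ∈ Ω, ∃ Z' ∈ Ω', ∀ i ∈ F, Z' (e i) = Z i) : orbCov F ε Ω ≤ orbCov F' ε Ω' := by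
  refine orbCov_le_of_forall fun Ω₁ h₁ =>
    ⟨(fun X => X ∘ e) '' Ω₁, fun Z hZ => ?_, Set.encard_image_le _ _⟩
  obtain ⟨Z', hZ', hZZ'⟩ := h Z hZ
  obtain ⟨u, hu, X, hX, hXZ⟩ := h₁ hZ'
  refine ⟨u, hu, X ∘ e, ⟨X, hX, rfl⟩, fun i hi => ?_⟩
  rw [← hZZ' i hi]
  exact hXZ (e i) (he i hi)

/-- The centres of a covering of Ω may lie outside Ω, where f is not controlled. Each useful centre
is therefore replaced by a point of Ω whose orbit passes within ε of it, which costs the factor 2.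
-/
theorem orbCov_le_of_map (hn : n ≠ 0) (f : (V → Mat n) → W → Mat n)
    (h : ∀ Z ∈ Ω', ∃ X ∈ Ω, ∀ X' ∈ Ω, ∀ u ∈ Matrix.unitaryGroup (Fin n) ℂ,
      (∀ i ∈ F, twoNorm (matTr n) (X i - u * X' i * star u) < 2 * ε) →
        ∀ j ∈ F', twoNorm (matTr n) (Z j - u * f X' j * star u) < ε') :
    orbCov F' ε' Ω' ≤ orbCov F ε Ω := by
  classical
  have hτ := matTr_isTracialState hn
  let P : (V → Mat n) → (V → Mat n) → Prop := fun X₁ X' => X' ∈ Ω ∧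
    ∃ u ∈ Matrix.unitaryGroup (Fin n) ℂ, ∀ i ∈ F, twoNorm (matTr n) (X' i - u * X₁ i * star u) < ε
  -- The default is irrelevant: a centre without a nearby point of Ω covers nothing in Ω.
  let c : (V → Mat n) → V → Mat n := fun X₁ => if h : ∃ X', P X₁ X' then h.choose else X₁
  refine orbCov_le_of_forall fun Ω₁ h₁ =>
    ⟨(fun X => f (c X)) '' Ω₁, fun Z hZ => ?_, Set.encard_image_le _ _⟩
  obtain ⟨X, hX, hXZ⟩ := h Z hZ
  obtain ⟨u, hu, X₁, hX₁, hu'⟩ := h₁ hX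
  have hex : ∃ X', P X₁ X' := ⟨X, hX, u, hu, hu'⟩
  have hc : P X₁ (c X₁) := by
    simp only [c, dif_pos hex]
    exact hex.choose_spec
  obtain ⟨hcΩ, u₀, hu₀, hcu⟩ := hc
  refine ⟨u * star u₀, mul_mem hu (Unitary.star_mem hu₀), _, ⟨X₁, hX₁, rfl⟩,
    hXZ _ hcΩ _ (mul_mem hu (Unitary.star_mem hu₀)) fun i hi => ?_⟩
  have h3 : twoNorm (matTr n) (u * X₁ i * star u - u * star u₀ * c X₁ i * star (u * star u₀)) < ε := by
    have e : u * X₁ i * star u - u * star u₀ * c X₁ i * star (u * star u₀) =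
        (u * star u₀) * (u₀ * X₁ i * star u₀ - c X₁ i) * star (u * star u₀) := by
      rw [mul_sub, sub_mul, star_mul, star_star]
      congr 1
      have h4 : star u₀ * u₀ = 1 := Unitary.star_mul_self_of_mem hu₀
      calc u * X₁ i * star u = u * (star u₀ * u₀) * X₁ i * (star u₀ * u₀) * star u := by
            rw [h4, mul_one, mul_one]
        _ = _ := by simp only [mul_assoc]
    rw [e, hτ.twoNorm_unitary_conj (mul_mem hu (Unitary.star_mem hu₀)), IsTracialState.twoNorm_sub_comm]
    exact hcu i hi
  have := hτ.twoNorm_sub_le (X i) (u * X₁ i * star u) (u * star u₀ * c X₁ i * star (u * star u₀))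
  have := hu' i hi
  linarith

end Covering

/-! ## Existential formulas -/

theorem isExOpen_setOf_lt (φ : ExFormula ℕ) (c : ℝ) :
    IsExOpen.{u} {ν | ν ∈ exTypes.{u} ∧ ν φ < c} := by
  refine ⟨fun ν hν => hν.1, fun r _ => ⟨fun ν hν => hν.2, fun μ hμ =>
    ⟨1, fun _ => φ, fun _ => c - μ φ, fun _ => sub_pos.2 hμ.1.2, fun ν hν => ⟨⟨?_, ?_⟩, hν.1⟩⟩⟩⟩
  · obtain ⟨⟨H, i1, i2, i3, M, X, -, h⟩, -⟩ := hν
    exact ⟨H, i1, i2, i3, M, X, h⟩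
  · have := hν.2 0
    linarith

/-- A quantifier-free formula as an existential formula. -/
def QFFormula.toEx {V : Type v} (ψ : QFFormula V) : ExFormula V where
  k := 0
  radius := Fin.elim0
  radius_pos i := i.elim0
  body := ψ.subst fun v => .var (Sum.inl v)

theorem QFFormula.eval_toEx {A : Type*} [Ring A] [StarRing A] [Algebra ℂ A] [Norm A] (τ : A → ℂ)
    {V : Type v} (X : V → A) (ψ : QFFormula V) : ψ.toEx.eval τ X = ψ.eval τ X := by
  have : ((fun Y : Fin ψ.toEx.k → A => ψ.toEx.body.eval τ (Sum.elim X Y)) ''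
      ballProd ψ.toEx.radius) = {ψ.eval τ X} := by
    ext z
    constructor
    · rintro ⟨Y, -, rfl⟩
      simp [QFFormula.toEx, QFFormula.eval_subst, TrTerm.eval]
      rfl
    · rintro rfl
      refine ⟨Fin.elim0, fun i => i.elim0, ?_⟩
      simp [QFFormula.toEx, QFFormula.eval_subst, TrTerm.eval]
  rw [ExFormula.eval, this, csInf_singleton]

/-- The sum of continuous functions of finitely many formulas. -/
def QFFormula.sum {V : Type v} {ι : Type*} [Fintype ι] (g : ι → C(ℝ, ℝ)) (φ : ι → QFFormula V) :
    QFFormula V :=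
  .conn (k := Fintype.card ι)
    ⟨fun x => ∑ i, g i (x (Fintype.equivFin ι i)), by fun_prop⟩
    fun i => φ ((Fintype.equivFin ι).symm i)

theorem QFFormula.eval_sum {A : Type*} [Ring A] [StarRing A] [Algebra ℂ A] (τ : A → ℂ)
    {V : Type v} (X : V → A) {ι : Type*} [Fintype ι] (g : ι → C(ℝ, ℝ)) (φ : ι → QFFormula V) :
    (QFFormula.sum g φ).eval τ X = ∑ i, g i ((φ i).eval τ X) := by
  simp [QFFormula.sum, QFFormula.eval]

/-- The uniform bound on the body shows that the set of values is bounded below, without which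
`sInf` would not be a lower bound. -/
theorem ExFormula.eval_le {A : Type u} [CStarAlgebra A] [Nontrivial A] {τ : A → ℂ}
    (hτ : IsTracialState τ) {V : Type v} (X : V → A) (φ : ExFormula V) {Y : Fin φ.k → A}
    (hY : Y ∈ ballProd φ.radius) : φ.eval τ X ≤ φ.body.eval τ (Sum.elim X Y) := by
  obtain ⟨B, hB⟩ := φ.body.exists_bound.{u} (Sum.elim (fun v => ‖X v‖) φ.radius)
  refine csInf_le ⟨-B, ?_⟩ ⟨Y, hY, rfl⟩
  rintro _ ⟨Y', hY', rfl⟩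
  refine (abs_le.1 (hB A τ hτ _ ?_)).1
  rintro (v | i)
  exacts [le_rfl, hY' i]

theorem ExFormula.exists_lt_of_eval_lt {A : Type u} [CStarAlgebra A] {τ : A → ℂ}
    {V : Type v} {X : V → A} {φ : ExFormula V} {c : ℝ} (h : φ.eval τ X < c) :
    ∃ Y ∈ ballProd φ.radius, φ.body.eval τ (Sum.elim X Y) < c := by
  obtain ⟨_, ⟨Y, hY, rfl⟩, hlt⟩ := exists_lt_of_csInf_lt
    (Set.Nonempty.image _ ⟨0, fun i => by simpa using (φ.radius_pos i).le⟩) h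
  exact ⟨Y, hY, hlt⟩

/-- In the algebra generated by `X`, the quantifiers of an existential formula may be replaced by
terms in `X`. -/
theorem TracialVNAlgebra.exists_term_of_eval_lt {H : Type u} [NormedAddCommGroup H]
    [InnerProductSpace ℂ H] [CompleteSpace H] (N : TracialVNAlgebra H) {V : Type v} {X : V → N.Elt}
    {r : V → ℝ} (hX : X ∈ ballProd r) (hgen : ∀ y : N.Elt, (y : H →L[ℂ] H) ∈ N.wstar X)
    (Z : ℕ → N.Elt) {φ : ExFormula ℕ} {c : ℝ} (h : φ.eval N.trace Z < c) :
    ∃ σ : Fin φ.k → TrTerm V, φ.body.eval N.trace (Sum.elim Z fun i => (σ i).eval X) < c ∧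
      ∀ i (A : Type w) [CStarAlgebra A] [Nontrivial A] (X' : V → A), X' ∈ ballProd r →
        ‖(σ i).eval X'‖ ≤ φ.radius i := by
  obtain ⟨Y, hY, hlt⟩ := ExFormula.exists_lt_of_eval_lt h
  -- Terms within 1/(m + 1) of the witnesses make the body converge, so a late m keeps the strict
  -- inequality.
  have h1 : ∀ (m : ℕ) (i : Fin φ.k), _ := fun m i =>
    N.exists_term_norm_le.{u, v, w} hX (hgen (Y i)) (φ.radius_pos i) (hY i)
      (Nat.one_div_pos_of_nat (α := ℝ) (n := m))
  choose σ hσ1 hσ2 hσ3 using h1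
  have hlim := φ.body.tendsto_eval (r := Sum.elim (fun v => ‖Z v‖) φ.radius) N.isTracialState
    (l := atTop) (x := fun m => Sum.elim Z fun i => (σ m i).eval X) (y := Sum.elim Z Y)
    (by rintro m (v | i); exacts [le_rfl, hσ2 m i]) (by rintro (v | i); exacts [le_rfl, hY i])
    (by
      rintro (v | i)
      · simp [N.isTracialState.twoNorm_zero]
      · refine squeeze_zero (fun m => twoNorm_nonneg _ _) (fun m => ?_)
          tendsto_one_div_add_atTop_nhds_zero_nat
        simp only [Sum.elim_inr]
        rw [IsTracialState.twoNorm_sub_comm]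
        exact (hσ1 m i).le)
  obtain ⟨m, hm⟩ := (hlim.eventually (eventually_lt_nhds hlt)).exists
  exact ⟨σ m, hm, fun i A _ _ X' hX' => hσ3 m i A X' hX'⟩

/-! ## Comparison of the microstate spaces -/

section Encoding

variable {V : Type v}

/-- The enumeration of the variables in a finite set, continued by zeros. -/
def encTerm (F : Finset V) (k : ℕ) : TrTerm V :=
  if h : k < F.card then .var (F.equivFin.symm ⟨k, h⟩) else .zero

/-- The radii of the variables in a finite set, continued by ones. -/
def encRadius (r : V → ℝ) (F : Finset V) (k : ℕ) : ℝ :=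
  if h : k < F.card then r (F.equivFin.symm ⟨k, h⟩) else 1

theorem encRadius_pos {r : V → ℝ} (hr : ∀ i, 0 < r i) (F : Finset V) (k : ℕ) :
    0 < encRadius r F k := by
  unfold encRadius
  split_ifs
  exacts [hr _, one_pos]

theorem eval_encTerm_mem_ballProd {A : Type*} [CStarAlgebra A] {r : V → ℝ} {X : V → A}
    (hX : X ∈ ballProd r) (F : Finset V) :
    (fun k => (encTerm F k).eval X) ∈ ballProd (encRadius r F) := by
  intro k
  by_cases h : k < F.card
  · simpa [encRadius, encTerm, h, TrTerm.eval] using hX _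
  · simp [encRadius, encTerm, h, TrTerm.eval]

theorem exists_encTerm_eq (F : Finset V) : ∃ e : V → ℕ, ∀ i ∈ F, encTerm F (e i) = .var i := by
  classical
  refine ⟨fun i => if h : i ∈ F then F.equivFin ⟨i, h⟩ else 0, fun i hi => ?_⟩
  simp [encTerm, hi]

theorem eval_encTerm {A : Type*} [Ring A] [StarRing A] [Algebra ℂ A] (F : Finset V) (X : V → A)
    (k : ℕ) : (encTerm F k).eval X = 0 ∨ ∃ i, (encTerm F k).eval X = X i := by
  unfold encTerm
  split_ifs
  exacts [.inr ⟨_, rfl⟩, .inl rfl]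

end Encoding

section Comparison

variable {H : Type u} [NormedAddCommGroup H] [InnerProductSpace ℂ H] [CompleteSpace H]
  (N : TracialVNAlgebra H) {I : Type v} {J : Type w} {T : I ⊕ J → N.Elt} {r : I ⊕ J → ℝ}

theorem nontrivial_mat {n : ℕ} (hn : n ≠ 0) : Nontrivial (Mat n) := by
  have : NeZero n := ⟨hn⟩
  infer_instance

/-- Every existential neighbourhood of the type of the tuple `T` restricted to a finite set
dominates a quantifier-free neighbourhood of the type of `T`. -/
theorem TracialVNAlgebra.exists_qf_nhds_orbCov_le (hT : T ∈ ballProd r) (hr : ∀ v, 0 < r v)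
    (hgen : ∀ y : N.Elt, (y : H →L[ℂ] H) ∈ N.wstar T) (F : Finset I) (ε : ℝ) :
    ∃ (Z : ℕ → N.Elt) (t : ℕ → ℝ) (F' : Finset ℕ), (∀ k, Z k = 0 ∨ ∃ i, Z k = T (Sum.inl i)) ∧
      (∀ k, 0 < t k) ∧ ∀ O, IsExOpen.{u} O → exType N.trace Z ∈ O → ∃ O' ⊆ qfTypes.{u} r,
        O' ∈ 𝓝[qfTypes.{u} r] (qfType N.trace T) ∧ ∀ n, n ≠ 0 →
          orbCov F ε ((fun Z : I ⊕ J → Mat n => Z ∘ Sum.inl) '' qfMicrostates r n O') ≤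
            orbCov F' ε (exMicrostates t n O) := by
  classical
  obtain ⟨e, he⟩ := exists_encTerm_eq F
  let σ₀ : ℕ → TrTerm (I ⊕ J) := fun k => (encTerm F k).subst fun i => .var (Sum.inl i)
  have hσ₀ : ∀ {A : Type u} [CStarAlgebra A] (X : I ⊕ J → A) (k : ℕ),
      (σ₀ k).eval X = (encTerm F k).eval (fun i => X (Sum.inl i)) := fun X k =>
    TrTerm.eval_subst _ _ _
  -- The same identity again, at the universe of the matrix algebras.
  have hσ₀' : ∀ {A : Type} [CStarAlgebra A] (X : I ⊕ J → A) (k : ℕ),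
      (σ₀ k).eval X = (encTerm F k).eval (fun i => X (Sum.inl i)) := fun X k =>
    TrTerm.eval_subst _ _ _
  set t := encRadius (fun i => r (Sum.inl i)) F
  have ht : ∀ k, 0 < t k := encRadius_pos (fun i => hr _) F
  set Z : ℕ → N.Elt := fun k => (σ₀ k).eval T with hZdef
  have hZ : Z ∈ ballProd t := by
    have := eval_encTerm_mem_ballProd (A := N.Elt) (r := fun i => r (Sum.inl i))
      (X := fun i => T (Sum.inl i)) (fun i => hT _) F
    intro k
    have e1 : Z k = (encTerm F k).eval (fun i => T (Sum.inl i)) := hσ₀ T k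
    rw [e1]
    exact this k
  refine ⟨Z, t, F.image e, fun k => ?_, ht, fun O hO hμ => ?_⟩
  · have e1 : Z k = (encTerm F k).eval (fun i => T (Sum.inl i)) := hσ₀ T k
    rw [e1]
    exact eval_encTerm F _ k
  obtain ⟨m, φ, η, hη, hsub⟩ := (hO.2 t ht).2 _
    ⟨hμ, H, inferInstance, inferInstance, inferInstance, N, Z, hZ, rfl⟩
  have h0 : ∀ j, (φ j).eval N.trace Z < exType N.trace Z (φ j) + η j := fun j =>
    lt_add_of_pos_right _ (hη j)
  -- Generation of N by T enters here: the quantifiers become terms in T, whose norm bounds persist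
  -- for matrices.
  choose σ hσ1 hσ2 using fun j => N.exists_term_of_eval_lt.{u, max v w, 0} hT hgen Z (h0 j)
  let ψ : Fin m → QFFormula (I ⊕ J) := fun j => (φ j).body.subst (Sum.elim σ₀ (σ j))
  have hψ : ∀ j, qfType N.trace T (ψ j) < exType N.trace Z (φ j) + η j := fun j => by
    have := QFFormula.eval_subst N.trace (Sum.elim σ₀ (σ j)) T (φ j).body
    have e1 : (fun v => (Sum.elim σ₀ (σ j) v).eval T) =
        Sum.elim Z fun i => (σ j i).eval T := by
      ext (v | v) <;> rfl
    rw [e1] at this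
    exact this.trans_lt (hσ1 j)
  refine ⟨qfTypes.{u} r ∩ {ν | ∀ j, ν (ψ j) < exType N.trace Z (φ j) + η j},
    Set.inter_subset_left, inter_mem_nhdsWithin _ (eventually_all.2 fun j =>
      (continuous_apply (ψ j)).continuousAt.eventually (eventually_lt_nhds (hψ j))), fun n hn => ?_⟩
  have := nontrivial_mat hn
  refine orbCov_le_of_reindex e (fun i hi => Finset.mem_image_of_mem _ hi) ?_
  rintro _ ⟨X', ⟨hX', -, hO'⟩, rfl⟩
  have hball : (fun k => (σ₀ k).eval X') ∈ ballProd t := by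
    simp only [hσ₀']
    exact eval_encTerm_mem_ballProd (r := fun i => r (Sum.inl i)) (fun i => hX' _) F
  refine ⟨fun k => (σ₀ k).eval X', ⟨hball, ?_⟩, fun i hi => ?_⟩
  -- The values of the terms σ at the microstate witness the infimum, so the quantifier-free bound
  -- implies the existential one.
  · refine (hsub ⟨exType_mem_exTypesBdd hn hball, fun j => ?_⟩).1
    have h1 := ExFormula.eval_le (matTr_isTracialState hn) (fun k => (σ₀ k).eval X') (φ j)
      (Y := fun i => (σ j i).eval X') (fun i => hσ2 j i _ X' hX')
    refine h1.trans_lt ?_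
    have h2 : ((φ j).body.subst (Sum.elim σ₀ (σ j))).eval (matTr n) X' <
      exType N.trace Z (φ j) + η j := hO' j
    rw [QFFormula.eval_subst] at h2
    have e1 : (fun v => (Sum.elim σ₀ (σ j) v).eval X') =
        Sum.elim (fun k => (σ₀ k).eval X') fun i => (σ j i).eval X' := by
      funext v
      rcases v with v | v <;> rfl
    rwa [e1] at h2
  · simp only [hσ₀', he i hi]
    rfl

/-- By faithfulness, a zero distance would identify z with its truncation, whose norm is at most ρ.
-/
theorem TracialVNAlgebra.ballCut_ne {ρ : ℝ} (hρ : 0 < ρ) {z : N.Elt} (hz : ρ < ‖z‖) :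
    0 < twoNorm N.trace (z - ballCut ρ z) := by
  refine lt_of_le_of_ne (twoNorm_nonneg _ _) fun h => ?_
  have h1 := N.isTracialState.re_sq (z - ballCut ρ z)
  rw [← h] at h1
  have h2 := N.trace_faithful (z - ballCut ρ z) (by rw [← h1]; simp)
  have h3 := norm_ballCut_le hρ z
  rw [← sub_eq_zero.1 h2] at h3
  exact absurd hz (not_lt.2 h3)

/-- If `Z` is not in `∏ D_{t_j}`, then this is witnessed by an existential neighbourhood of its
type. -/
theorem TracialVNAlgebra.exists_isExOpen_of_not_mem_ballProd {Z : ℕ → N.Elt} {t : ℕ → ℝ}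
    (ht : ∀ k, 0 < t k) (hZ : Z ∉ ballProd t) :
    ∃ O, IsExOpen.{u} O ∧ exType N.trace Z ∈ O ∧ ∀ n, n ≠ 0 → exMicrostates t n O = ∅ := by
  obtain ⟨j, hj⟩ : ∃ j, t j < ‖Z j‖ := by
    by_contra! h
    exact hZ h
  have hd := N.ballCut_ne (ht j) hj
  set d := twoNorm N.trace (Z j - ballCut (t j) (Z j))
  have hd3 : 0 < d / 3 := by positivity
  -- With error d/3, the polynomial truncation stays at distance at least 2d/3 from Z_j, but within
  -- d/3 of any element of norm at most t_j.
  obtain ⟨q, hq⟩ := exists_isCutoff (ht j) (norm_nonneg (Z j)) hd3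
  -- Open sets impose upper bounds only, so the lower bound on the distance is encoded by negation.
  let ψ : QFFormula ℕ := .conn (k := 1) ⟨fun x => -x 0, by fun_prop⟩
    fun _ => .dist (.var j) (.cut q (.var j))
  refine ⟨{ν | ν ∈ exTypes.{u} ∧ ν ψ.toEx < -(d / 3)}, isExOpen_setOf_lt _ _,
    ⟨⟨H, inferInstance, inferInstance, inferInstance, N, Z, rfl⟩, ?_⟩, fun n hn => ?_⟩
  · have e1 : ψ.toEx.eval N.trace Z = -twoNorm N.trace (Z j - polyCut q (Z j)) := by
      rw [QFFormula.eval_toEx]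
      have := TrTerm.eval_cut q Z (.var j)
      simp only [ψ, QFFormula.eval]
      rw [this]
      rfl
    change ψ.toEx.eval N.trace Z < _
    rw [e1]
    have h1 := N.isTracialState.twoNorm_sub_le (Z j) (polyCut q (Z j)) (ballCut (t j) (Z j))
    have h2 := (N.isTracialState.twoNorm_le_norm _).trans
      (hq.norm_polyCut_sub_le (ht j) hd3 le_rfl)
    change d ≤ _ at h1
    linarith
  · ext X
    simp only [Set.mem_empty_iff_false, iff_false]
    rintro ⟨hX, -, hlt⟩
    have e1 : ψ.toEx.eval (matTr n) X = -twoNorm (matTr n) (X j - polyCut q (X j)) := by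
      rw [QFFormula.eval_toEx]
      have := TrTerm.eval_cut q X (.var j)
      simp only [ψ, QFFormula.eval]
      rw [this]
      rfl
    change ψ.toEx.eval (matTr n) X < _ at hlt
    rw [e1] at hlt
    have h2 := ((matTr_isTracialState hn).twoNorm_le_norm _).trans
      (hq.norm_polyCut_sub_le (ht j) hd3 ((hX j).trans hj.le))
    rw [ballCut_eq_self (ht j) (hX j), IsTracialState.twoNorm_sub_comm] at h2
    linarith

end Comparison

/-! ### From quantifier-free to existential neighbourhoods -/

section Comparison

theorem exists_finset_of_mem_nhdsWithin_pi {ι : Type*} {s O : Set (ι → ℝ)} {μ : ι → ℝ}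
    (hO : O ∈ 𝓝[s] μ) : ∃ (S : Finset ι) (η : ι → ℝ), (∀ i, 0 < η i) ∧
      ∀ ν ∈ s, (∀ i ∈ S, |ν i - μ i| < η i) → ν ∈ O := by
  obtain ⟨a, ha, has⟩ := mem_nhdsWithin_iff_exists_mem_nhds_inter.1 hO
  rw [nhds_pi, Filter.mem_pi'] at ha
  obtain ⟨S, b, hb, hba⟩ := ha
  choose η hη hηb using fun i => Metric.mem_nhds_iff.1 (hb i)
  exact ⟨S, η, hη, fun ν hν h => has ⟨hba fun i hi => hηb i (h i hi), hν⟩⟩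

section Formulas

variable {V : Type v}

/-- The formula `∑_k d(z_k, p_k(x)) / δ + ∑_ψ |ψ(x) - c_ψ| / η_ψ`. -/
def approxFormula (F : Finset ℕ) (p : ℕ → TrTerm V) (δ : ℝ) (S : Finset (QFFormula V))
    (c η : QFFormula V → ℝ) : QFFormula (ℕ ⊕ V) :=
  QFFormula.sum (ι := F ⊕ S)
    (Sum.elim (fun _ => ⟨fun x => x / δ, by fun_prop⟩)
      fun ψ => ⟨fun x => |x - c ψ| / η ψ, by fun_prop⟩)
    (Sum.elim (fun k => .dist (.var (Sum.inl k)) ((p k).subst fun v => .var (Sum.inr v)))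
      fun ψ => (ψ : QFFormula V).subst fun v => .var (Sum.inr v))

theorem eval_approxFormula {A : Type*} [Ring A] [StarRing A] [Algebra ℂ A] (τ : A → ℂ)
    (F : Finset ℕ) (p : ℕ → TrTerm V) (δ : ℝ) (S : Finset (QFFormula V)) (c η : QFFormula V → ℝ)
    (Z : ℕ → A) (X : V → A) : (approxFormula F p δ S c η).eval τ (Sum.elim Z X) =
      ∑ k ∈ F, twoNorm τ (Z k - (p k).eval X) / δ + ∑ ψ ∈ S, |ψ.eval τ X - c ψ| / η ψ := by
  rw [approxFormula, QFFormula.eval_sum, Fintype.sum_sum_type, ← Finset.sum_coe_sort F,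
    ← Finset.sum_coe_sort S]
  simp [QFFormula.eval, QFFormula.eval_subst, TrTerm.eval_subst, TrTerm.eval]

/-- Bind the variables in a finite set by quantifiers and put the others equal to zero. -/
def ExFormula.bind {r : V → ℝ} (hr : ∀ v, 0 < r v) (Θ : QFFormula (ℕ ⊕ V)) (G : Finset V) :
    ExFormula ℕ :=
  open Classical in
  { k := G.card
    radius := fun i => r (G.equivFin.symm i)
    radius_pos := fun _ => hr _
    body := Θ.subst (Sum.elim (fun k => .var (Sum.inl k)) fun v =>
      if h : v ∈ G then .var (Sum.inr (G.equivFin ⟨v, h⟩)) else .zero) }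

open Classical in
theorem ExFormula.eval_body_bind {A : Type*} [Ring A] [StarRing A] [Algebra ℂ A] (τ : A → ℂ)
    {r : V → ℝ} (hr : ∀ v, 0 < r v) (Θ : QFFormula (ℕ ⊕ V)) (G : Finset V) (Z : ℕ → A)
    (Y : Fin G.card → A) : (ExFormula.bind hr Θ G).body.eval τ (Sum.elim Z Y) =
      Θ.eval τ (Sum.elim Z fun v => if h : v ∈ G then Y (G.equivFin ⟨v, h⟩) else 0) := by
  refine (QFFormula.eval_subst _ _ _ _).trans ?_
  congr 1
  funext v
  rcases v with k | v
  · rfl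
  · by_cases h : v ∈ G <;> simp [h, TrTerm.eval]

theorem ExFormula.exists_lt_of_eval_bind_lt {A : Type u} [CStarAlgebra A] {τ : A → ℂ}
    {r : V → ℝ} {hr : ∀ v, 0 < r v} {Θ : QFFormula (ℕ ⊕ V)} {G : Finset V} {Z : ℕ → A} {c : ℝ}
    (h : (ExFormula.bind hr Θ G).eval τ Z < c) :
    ∃ X ∈ ballProd r, Θ.eval τ (Sum.elim Z X) < c := by
  classical
  obtain ⟨Y, hY, hlt⟩ := ExFormula.exists_lt_of_eval_lt h
  refine ⟨_, fun v => ?_, (ExFormula.eval_body_bind τ hr Θ G Z Y).symm.trans_lt hlt⟩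
  split_ifs with hv
  · simpa [ExFormula.bind] using hY (G.equivFin ⟨v, hv⟩)
  · simpa using (hr v).le

/-- Take for G the variables on which Θ depends. The entries of X indexed by G are admissible
witnesses, and setting the others to zero does not change the value. -/
theorem ExFormula.exists_eval_bind_le {t : ℕ → ℝ} {r : V → ℝ} (hr : ∀ v, 0 < r v)
    (Θ : QFFormula (ℕ ⊕ V)) : ∃ G : Finset V, ∀ (A : Type u) [CStarAlgebra A] [Nontrivial A]
      (τ : A → ℂ), IsTracialState τ → ∀ Z ∈ ballProd t, ∀ X ∈ ballProd r,
        (ExFormula.bind hr Θ G).eval τ Z ≤ Θ.eval τ (Sum.elim Z X) := by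
  classical
  obtain ⟨K, hK⟩ := Θ.exists_support.{u} (Sum.elim t r)
  refine ⟨K.toRight, fun A _ _ τ hτ Z hZ X hX => ?_⟩
  refine (ExFormula.eval_le hτ Z _ (Y := fun i => X (K.toRight.equivFin.symm i))
    fun i => hX _).trans_eq ?_
  refine (ExFormula.eval_body_bind τ hr Θ _ Z _).trans (hK A τ hτ _ ?_ _ ?_ ?_)
  · rintro (k | v)
    · exact hZ k
    · simp only [Sum.elim_inr]
      split_ifs
      · rw [Equiv.symm_apply_apply]
        exact hX v
      · simpa using (hr v).le
  · rintro (k | v)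
    exacts [hZ k, hX v]
  · rintro (k | v) h
    · rfl
    · simp only [Sum.elim_inr, dif_pos (Finset.mem_toRight.2 h), Equiv.symm_apply_apply]

theorem TrTerm.eval_unitary_conj {A : Type u} [CStarAlgebra A] {W : A} (hW : W ∈ unitary A)
    (X : V → A) (t : TrTerm V) :
    t.eval (fun v => W * X v * star W) = W * t.eval X * star W :=
  t.eval_map (Unitary.conjStarAlgAut ℂ A ⟨W, hW⟩ : A →⋆ₐ[ℂ] A) X

theorem unitary_conj_mem_ballProd {A : Type u} [CStarAlgebra A] {W : A} (hW : W ∈ unitary A)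
    {X : V → A} {r : V → ℝ} (hX : X ∈ ballProd r) : (fun v => W * X v * star W) ∈ ballProd r :=
  fun v => (StarAlgEquiv.norm_map (Unitary.conjStarAlgAut ℂ A ⟨W, hW⟩) (X v)).trans_le (hX v)

end Formulas

variable {H : Type u} [NormedAddCommGroup H] [InnerProductSpace ℂ H] [CompleteSpace H]
  (N : TracialVNAlgebra H) {I : Type v} {J : Type w} {T : I ⊕ J → N.Elt} {r : I ⊕ J → ℝ}

/-- For a tuple `Z` in the W*-algebra generated by the first part of `T`, every quantifier-free
neighbourhood of the type of `T` dominates an existential neighbourhood of the type of `Z`. -/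
theorem TracialVNAlgebra.exists_ex_nhds_orbCov_le (hT : T ∈ ballProd r) (hr : ∀ v, 0 < r v)
    {Z : ℕ → N.Elt} (hZ : ∀ k, (Z k : H →L[ℂ] H) ∈ N.wstar fun i => T (Sum.inl i)) {t : ℕ → ℝ}
    (ht : ∀ k, 0 < t k) (F : Finset ℕ) {ε : ℝ} (hε : 0 < ε) :
    ∃ (G : Finset I) (ε' : ℝ), 0 < ε' ∧ ∀ O' ∈ 𝓝[qfTypes.{u} r] (qfType N.trace T), ∃ O,
      IsExOpen.{u} O ∧ exType N.trace Z ∈ O ∧ ∀ n, n ≠ 0 → orbCov F ε (exMicrostates t n O) ≤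
        orbCov G ε' ((fun Z : I ⊕ J → Mat n => Z ∘ Sum.inl) '' qfMicrostates r n O') := by
  classical
  by_cases hball : Z ∈ ballProd t
  swap
  · obtain ⟨O, hO, hZO, h0⟩ := N.exists_isExOpen_of_not_mem_ballProd ht hball
    refine ⟨∅, 1, one_pos, fun O' _ => ⟨O, hO, hZO, fun n hn => ?_⟩⟩
    rw [h0 n hn, orbCov_empty]
    exact bot_le
  set δ := ε / 2
  have hδ : 0 < δ := half_pos hε
  -- After division by δ, the sum of the F.card errors stays below 1.
  have hκ : 0 < δ / (F.card + 1) := by positivity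
  choose p hp using fun k => N.exists_term_twoNorm_lt (fun i => T (Sum.inl i)) (hZ k) hκ
  choose B G hB h1 h2 using fun k => (p k).controlled.{0} (fun i => r (Sum.inl i))
  obtain ⟨δ', hδ', hδ'0⟩ :=
    (((Finset.eventually_all F).2 fun k _ => h2 k δ hδ).and self_mem_nhdsWithin).exists
  -- The scale must be fixed before O' is given. It is half the modulus because `orbCov_le_of_map`
  -- doubles it.
  refine ⟨F.biUnion G, δ' / 2, half_pos hδ'0, fun O' hO' => ?_⟩
  obtain ⟨S, η, hη, hsub⟩ := exists_finset_of_mem_nhdsWithin_pi hO'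
  set c := qfType N.trace T
  let p' : ℕ → TrTerm (I ⊕ J) := fun k => (p k).subst fun i => .var (Sum.inl i)
  -- All summands are nonnegative, so the single bound Θ < 1 forces each approximation separately.
  set Θ := approxFormula F p' δ S c η
  obtain ⟨K, hK⟩ := ExFormula.exists_eval_bind_le.{u} (t := t) hr Θ
  refine ⟨{ν | ν ∈ exTypes.{u} ∧ ν (ExFormula.bind hr Θ K) < 1}, isExOpen_setOf_lt _ _,
    ⟨⟨H, inferInstance, inferInstance, inferInstance, N, Z, rfl⟩, ?_⟩, fun n hn => ?_⟩
  · refine (hK _ N.trace N.isTracialState Z hball T hT).trans_lt ?_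
    have e1 := eval_approxFormula N.trace F p' δ S c η Z T
    refine e1.trans_lt ?_
    have e2 : ∑ ψ ∈ S, |ψ.eval N.trace T - c ψ| / η ψ = 0 :=
      Finset.sum_eq_zero fun ψ _ => by
        have : ψ.eval N.trace T - c ψ = 0 := sub_self _
        rw [this, abs_zero, zero_div]
    rw [e2, add_zero]
    calc ∑ k ∈ F, twoNorm N.trace (Z k - (p' k).eval T) / δ
        ≤ ∑ k ∈ F, (1 / (F.card + 1) : ℝ) := Finset.sum_le_sum fun k _ => by
          have e3 : (p' k).eval T = (p k).eval fun i => T (Sum.inl i) := TrTerm.eval_subst _ _ _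
          rw [div_le_iff₀ hδ, e3]
          exact (hp k).le.trans_eq (by ring)
      _ < 1 := by
          rw [Finset.sum_const, nsmul_eq_mul, mul_one_div, div_lt_one (by positivity)]
          linarith
  · have := nontrivial_mat hn
    have hτ := matTr_isTracialState hn
    refine orbCov_le_of_map hn (fun X k => (p k).eval X) ?_
    rintro Z' ⟨-, -, hlt⟩
    obtain ⟨X, hX, hXlt⟩ := ExFormula.exists_lt_of_eval_bind_lt hlt
    have e1 := eval_approxFormula (matTr n) F p' δ S c η Z' X
    replace hXlt := e1.symm.trans_lt hXlt
    have n1 : ∀ k ∈ F, 0 ≤ twoNorm (matTr n) (Z' k - (p' k).eval X) / δ := fun k _ =>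
      div_nonneg (twoNorm_nonneg _ _) hδ.le
    have n2 : ∀ ψ ∈ S, 0 ≤ |ψ.eval (matTr n) X - c ψ| / η ψ := fun ψ _ =>
      div_nonneg (abs_nonneg _) (hη ψ).le
    have s1 := Finset.sum_nonneg n1
    have s2 := Finset.sum_nonneg n2
    refine ⟨X ∘ Sum.inl, ⟨X, ⟨hX, hsub _ (qfType_mem_qfTypes hn hX) fun ψ hψ => ?_⟩, rfl⟩, ?_⟩
    · have := Finset.single_le_sum n2 hψ
      change |ψ.eval (matTr n) X - c ψ| < η ψ
      rw [← div_lt_one (hη ψ)]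
      linarith
    · rintro _ ⟨X', ⟨hX', -⟩, rfl⟩ W hW hclose j hj
      have a1 : twoNorm (matTr n) (Z' j - (p' j).eval X) < δ := by
        have := Finset.single_le_sum n1 hj
        exact (div_lt_one hδ).1 (by linarith)
      have e2 : (p' j).eval X = (p j).eval (X ∘ Sum.inl) := TrTerm.eval_subst _ _ _
      -- The modulus of p_j compares X with the conjugate of X'; p_j then commutes with the
      -- conjugation. Together with the bound on Z' - p(X), this uses up the two halves of ε.
      have a2 := hδ' j hj (Mat n) (matTr n) hτ (X ∘ Sum.inl) (fun i => hX _)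
        (fun i => W * (X' ∘ Sum.inl) i * star W)
        (unitary_conj_mem_ballProd hW (fun i => hX' _)) fun i hi => by
          have := hclose i (Finset.mem_biUnion.2 ⟨j, hj, hi⟩)
          exact (this.trans_eq (by ring)).le
      beta_reduce at a2
      rw [TrTerm.eval_unitary_conj hW] at a2
      rw [e2] at a1
      have := hτ.twoNorm_sub_le (Z' j) ((p j).eval (X ∘ Sum.inl))
        (W * (p j).eval (X' ∘ Sum.inl) * star W)
      refine this.trans_lt ((add_lt_add_of_lt_of_le a1 a2).trans_eq ?_)
      exact add_halves ε

theorem TracialVNAlgebra.coe_mem_wstar (M : TracialVNAlgebra H) {V : Type*} (X : V → M.Elt)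
    (i : V) : (X i : H →L[ℂ] H) ∈ M.wstar X :=
  (vnGenerated_le_iff _ _).1 (le_refl (M.wstar X)) ⟨i, rfl⟩

end Comparison

end

/-! ### The two inequalities -/

theorem mainTheorem7 (U : Ultrafilter ℕ) (hU : (U : Filter ℕ) ≤ Filter.cofinite)
    {H : Type u} [NormedAddCommGroup H] [InnerProductSpace ℂ H] [CompleteSpace H]
    (M : TracialVNAlgebra H) {I : Type v} {J : Type w}
    (X : I → M.Elt) (Y : J → M.Elt) (r : I → ℝ) (r' : J → ℝ)
    (hr : ∀ i, 0 < r i) (hr' : ∀ j, 0 < r' j)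
    (hX : ∀ i, ‖X i‖ ≤ r i) (hY : ∀ j, ‖Y j‖ ≤ r' j) :
    presenceEntropy U M r r' X Y =
      existentialEntropy U
        (M.restrict (M.wstar (Sum.elim X Y)) (M.wstar_le (Sum.elim X Y)))
        (M.wstar X) (M.wstar_le_wstar_sumElim X Y) := by
  set N := M.restrict (M.wstar (Sum.elim X Y)) (M.wstar_le (Sum.elim X Y)) with hN
  let T : I ⊕ J → N.Elt := fun v => ⟨_, M.coe_mem_wstar (Sum.elim X Y) v⟩
  have hT : T ∈ ballProd (Sum.elim r r') := by
    rintro (i | j)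
    exacts [hX i, hY j]
  have hpos : ∀ v, 0 < Sum.elim r r' v := by
    rintro (i | j)
    exacts [hr i, hr' j]
  have hgen : ∀ y : N.Elt, (y : H →L[ℂ] H) ∈ N.wstar T := fun y => y.2
  -- Quantifier-free types do not see the ambient algebra, so M may be replaced by N.
  have hq : qfType M.trace (Sum.elim X Y) = qfType N.trace T := funext fun ψ =>
    ψ.eval_map (StarSubalgebra.inclusion (M.wstar_le (Sum.elim X Y))) (fun _ => rfl) T
  apply le_antisymm
  · refine iSup₂_le fun ε hε => iSup_le fun F => ?_
    obtain ⟨Z, t, F', hZ, ht, h⟩ := N.exists_qf_nhds_orbCov_le hT hpos hgen F ε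
    have hZ₀ : ∀ k, ∃ z : (M.wstar X).toStarSubalgebra,
        StarSubalgebra.inclusion (M.wstar_le_wstar_sumElim X Y) z = Z k := by
      intro k
      -- The padding zeros and the X_i all lie in W*(X), so Z is admissible in the outer supremum.
      rcases hZ k with h0 | ⟨i, hi⟩
      · exact ⟨0, by rw [h0]; rfl⟩
      · exact ⟨⟨_, M.coe_mem_wstar X i⟩, by rw [hi]; rfl⟩
    choose Z₀ hZ₀ using hZ₀
    refine le_iSup_of_le Z₀ (le_iSup₂_of_le t ht (le_iSup_of_le F' (le_iSup₂_of_le ε hε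
      (le_iInf₂ fun O hO => le_iInf fun hK => ?_))))
    have e1 : (fun k => StarSubalgebra.inclusion (M.wstar_le_wstar_sumElim X Y) (Z₀ k)) = Z :=
      funext hZ₀
    obtain ⟨O', hO'1, hO'2, hO'3⟩ := h O hO
      ((congrArg (fun z => exType N.trace z ∈ O) e1).mp (hK (Set.mem_singleton _)))
    refine iInf₂_le_of_le O' hO'1 (iInf_le_of_le (by rw [hq]; exact hO'2) (growthRate_mono ?_))
    filter_upwards [eventually_ne_zero_of_le_cofinite hU] with n hn
    exact hO'3 n hn
  · refine iSup_le fun Z => iSup₂_le fun t ht => iSup_le fun F => iSup₂_le fun ε hε => ?_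
    obtain ⟨G, ε', hε', h⟩ := N.exists_ex_nhds_orbCov_le hT hpos
      (Z := fun k => StarSubalgebra.inclusion (M.wstar_le_wstar_sumElim X Y) (Z k))
      (fun k => (Z k).2) ht F hε
    refine le_iSup₂_of_le ε' hε' (le_iSup_of_le G (le_iInf₂ fun O' _ => le_iInf fun hO' => ?_))
    rw [hq] at hO'
    obtain ⟨O, hO, hZO, hle⟩ := h O' hO'
    refine iInf₂_le_of_le O hO (iInf_le_of_le (Set.singleton_subset_iff.2 hZO)
      (growthRate_mono ?_))
    filter_upwards [eventually_ne_zero_of_le_cofinite hU] with n hn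
    exact hle n hn
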